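/- **Setting.** Let $\Omega$ be a ground set of $n$ base arms and $1\le k\le n$. There are $m'$ agents, $1\le m\le m'$, and a horizon $T\ge 2$. If agent $i$ plays a set $A$ with $|A|\le k$ at time $t$, it receives a reward $f_{i,t}(A)\in[0,1]$. The random reward functions $f_{i,t}$ are i.i.d. over agents and times, and $\mathbb E f_{i,t}(A)=f(A)$ for $|A|\le k$, where $f:2^\Omega\to[0,\infty)$ is submodular (not necessarily monotone). Let $S^\star$ maximize $f$ over $\{|A|\le k\}$. The $\frac1e$-regret of agent $i$, which plays $S_{i,t}$ at time $t$, is $\mathcal R_i(T)=\sum_{t=1}^T\big(\tfrac1e f_{i,t}(S^\star)-f_{i,t}(S_{i,t})\big)$. **RandomSampling** with accuracy $\epsilon$: let $q=\min\{\lceil pn\rceil^+,n\}$ with $p=8k^{-1}\epsilon^{-2}\ln(2/\epsilon)$, and $s=kq/n$; start from $S_0=\varnothing$. For $i=1,\dots,k$ draw independently a uniformly random $q$-subset $M_i\subseteq\Omega$ and $d_i$ uniform on $(0,s]$, query the values of $S_{i-1}$ and of $S_{i-1}\cup\{u\}$ for all $u\in M_i$, let $u_i\in M_i$ be the element with the $\lceil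 d_i\rceil$-th largest (reported) marginal value with respect to $S_{i-1}$, and set $S_i=S_{i-1}\cup\{u_i\}$ if this marginal is $\ge 0$, and $S_i=S_{i-1}$ otherwise (also if $M_i=\varnothing$). Output $S_k$. **C-MA-MAB** with this subroutine uses the parameters $\beta=2$, $\gamma=1$, $\psi=n$, $\delta=4k$, that is, $$r=\Big\lceil m^{-1}\Big(4k\sqrt{\log T}\,(Tm/n)^{1/3}\Big)^{6/5}\Big\rceil,\qquad \epsilon^\star=(nr/T)^{1/3}.$$ It runs RandomSampling with accuracy $\epsilon^\star$. For every queried set $A$ there is one communication round: all $m'$ agents play $A$ for $r$ time steps, a fresh uniformly random set of $m$ agents upload their local means of the $r$ rewards, and the average of these $m$ means is returned to RandomSampling as the value of $A$. After its last query all agents play its output until time $T$ (if $T$ is reached before that, the run stops there). The reward functions, the selections of agents and the randomness of RandomSampling are independent. **Statement.** There are absolute constants $C>0$ and $a\ge 0$ such that: 1. For all $1\le k\le n$, $1\le m\le m'$ and $T\ge2$, and any reward distribution, the number of communication rounds is almost surely at most $C(\log T)^a\, n\,T^{2/3}$, i.e. $\tilde{\mathcal O}(nT^{2/3})$. 2.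 If in addition $T\ge n\,m^{3/2}/(4k)^3$, then for every reward model as above and every agent $i$, the regret $\mathcal R_i(T)$ is integrable and $$\mathbb E[\mathcal R_i(T)]\le C(\log T)^a\; m^{-1/5}k^{2/5}n^{1/5}T^{4/5},$$ i.e. the expected $\frac1e$-regret is $\tilde{\mathcal O}(m^{-1/5}k^{2/5}n^{1/5}T^{4/5})$. -/

import Mathlib

open MeasureTheory

namespace CMAMAB

noncomputable section

/-! ### Set functions -/

/-- Submodularity (diminishing returns) of a set function on the ground set `Fin n`. -/
def IsSubmodular {n : ℕ} (f : Finset (Fin n) → ℝ) : Prop :=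
  ∀ A B : Finset (Fin n), A ⊆ B → ∀ v, v ∉ B →
    f (insert v B) - f B ≤ f (insert v A) - f A

/-- `S` maximizes `f` among the subsets of size at most `k`. -/
def IsOptimal {n : ℕ} (f : Finset (Fin n) → ℝ) (k : ℕ) (S : Finset (Fin n)) : Prop :=
  S.card ≤ k ∧ ∀ A : Finset (Fin n), A.card ≤ k → f A ≤ f S

/-- `ν` is the law of one stochastic reward function `A ↦ f_t(A)`. On every feasible action
(size at most `k`) the reward lies in `[0,1]` and has mean `f A`. -/
def IsRewardLaw {n : ℕ} (k : ℕ) (f : Finset (Fin n) → ℝ)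
    (ν : Measure (Finset (Fin n) → ℝ)) : Prop :=
  ∀ A : Finset (Fin n), A.card ≤ k →
    (∀ᵐ x ∂ν, x A ∈ Set.Icc (0 : ℝ) 1) ∧ ∫ x, x A ∂ν = f A

/-! ### Offline algorithms with a value oracle -/

/-- A deterministic program which adaptively queries a value oracle on subsets of `Fin n` and
finally outputs a subset. -/
inductive QueryProgram (n : ℕ) : Type
  | done (Θ : Finset (Fin n)) : QueryProgram n
  | query (A : Finset (Fin n)) (next : ℝ → QueryProgram n) : QueryProgram n

/-- The list of the sets queried, in order, and the final output, when the `j`-th query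
(counted from the current value of `j`), if it asks for `A`, is answered by `ans j A`. -/
def QueryProgram.transcript {n : ℕ} (ans : ℕ → Finset (Fin n) → ℝ) :
    QueryProgram n → ℕ → List (Finset (Fin n)) × Finset (Fin n)
  | .done Θ, _ => ([], Θ)
  | .query A next, j =>
      let rest := QueryProgram.transcript ans (next (ans j A)) (j + 1)
      (A :: rest.1, rest.2)

/-- A randomized offline algorithm: it draws a seed and then runs a deterministic program. -/
structure OfflineAlgorithm (n : ℕ) where
  Seed : Type
  [measurableSpaceSeed : MeasurableSpace Seed]
  law : Measure Seed
  [isProbabilityMeasure_law : IsProbabilityMeasure law]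
  program : Seed → QueryProgram n

attribute [instance] OfflineAlgorithm.measurableSpaceSeed
attribute [instance] OfflineAlgorithm.isProbabilityMeasure_law

/-- The uniform distribution on the subsets of `Fin N` with exactly `q` elements
(for `q ≤ N`; otherwise there are none, and the value is the point mass at `∅`). -/
def uniformSubset (N q : ℕ) : PMF (Finset (Fin N)) :=
  if h : (Finset.powersetCard q (Finset.univ : Finset (Fin N))).Nonempty then
    PMF.uniformOfFinset _ h
  else PMF.pure ∅

/-- The uniform distribution on the interval `(0, 1]`. -/
def uniformUnit : Measure ℝ := volume.restrict (Set.Ioc 0 1)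

instance : IsProbabilityMeasure uniformUnit :=
  ⟨by simp [uniformUnit]⟩

/-! ### RandomSampling -/

/-- Query `S ∪ {u}` for all `u` in the list, recording the answers in `b`, then continue. -/
def queryEach {n : ℕ} (S : Finset (Fin n)) :
    List (Fin n) → (Fin n → ℝ) → ((Fin n → ℝ) → QueryProgram n) → QueryProgram n
  | [], b, cont => cont b
  | u :: l, b, cont => .query (insert u S) fun y => queryEach S l (Function.update b u y) cont

/-- The position (starting from `1`) of `u` when the elements of `M` are listed by
non-increasing value of `g`, ties being broken by the index. -/
def rankIn {n : ℕ} (M : Finset (Fin n)) (g : Fin n → ℝ) (u : Fin n) : ℕ :=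
  open scoped Classical in
  (M.filter fun v => g u < g v ∨ (g v = g u ∧ v < u)).card + 1

/-- One update of RandomSampling: the element of `M` with the `⌈d⌉`-th largest marginal `g` is
added to `S` if its marginal is nonnegative. -/
def rsUpdate {n : ℕ} (M : Finset (Fin n)) (d : ℝ) (g : Fin n → ℝ) (S : Finset (Fin n)) :
    Finset (Fin n) :=
  open scoped Classical in
  S ∪ M.filter fun u => rankIn M g u = ⌈d⌉₊ ∧ 0 ≤ g u

/-- The main loop of RandomSampling, one iteration for each entry `(M, U)` of the list. The
iteration queries the current solution `S` and all `S ∪ {u}`, `u ∈ M`, and updates `S` with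
`d = s * U`, which is uniform on `(0, s]` when `U` is uniform on `(0, 1]`. -/
def rsLoop {n : ℕ} (s : ℝ) : List (Finset (Fin n) × ℝ) → Finset (Fin n) → QueryProgram n
  | [], S => .done S
  | (M, U) :: l, S =>
      .query S fun a =>
        queryEach S (M.sort (· ≤ ·)) 0 fun b =>
          rsLoop s l (rsUpdate M (s * U) (fun u => b u - a) S)

/-- The sample size `min {⌈p n⌉, n}` with `p = 8 k⁻¹ ε⁻² ln (2 / ε)`. -/
def rsSampleSize (n k : ℕ) (ε : ℝ) : ℕ :=
  min ⌈8 * (k : ℝ)⁻¹ * (ε ^ 2)⁻¹ * Real.log (2 / ε) * n⌉₊ n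

/-- RandomSampling with cardinality bound `k` and accuracy `ε`: `k` iterations starting from
`∅`, each with an independent uniform sample `M` of `rsSampleSize n k ε` elements and an
independent `d` uniform on `(0, s]`, where `s = k * rsSampleSize n k ε / n`. -/
def randomSampling (n k : ℕ) (ε : ℝ) : OfflineAlgorithm n where
  Seed := Fin k → Finset (Fin n) × ℝ
  law := Measure.pi fun _ =>
    (uniformSubset n (rsSampleSize n k ε)).toMeasure.prod uniformUnit
  program seed := rsLoop ((k : ℝ) * rsSampleSize n k ε / n) (List.ofFn seed) ∅

/-! ### The federated bandit algorithm C-MA-MAB -/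

/-- The number `r_i^⋆` of times each agent plays every queried action. -/
def playsPerRound (β ψ δ : ℝ) (m T : ℕ) : ℕ :=
  ⌈(m : ℝ)⁻¹ *
    (δ * √(Real.log T) * ((T * m : ℝ) / ψ) ^ (1 / (β + 1))) ^ ((2 + 2 * β) / (3 + β))⌉₊

open scoped Classical in
/-- The accuracy `ε^⋆` with which the subroutine is run. -/
def accuracy (β γ ψ δ : ℝ) (m T : ℕ) : ℝ :=
  if 0 < β ∨ 0 < γ then (ψ * playsPerRound β ψ δ m T / T) ^ (1 / (β + 1)) else 0

/-- An outcome of all the randomness for `m'` agents: the reward `f_t(A)` which agent `i` receives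
if it plays `A` at time `t`, the set of agents which communicate in round `j`, and the seed of
the offline algorithm. -/
abbrev Outcome (n m' : ℕ) (alg : OfflineAlgorithm n) : Type :=
  (Fin m' × ℕ → Finset (Fin n) → ℝ) × (ℕ → Finset (Fin m')) × alg.Seed

/-- The law of the outcome: the reward functions are i.i.d. with law `ν` over agents and times, the
communicating agents of each round are a fresh uniformly random set of `m` of the `m'` agents, and
rewards, selections and the seed are independent. -/
def outcomeLaw {n : ℕ} (m' m : ℕ) (alg : OfflineAlgorithm n)
    (ν : Measure (Finset (Fin n) → ℝ)) : Measure (Outcome n m' alg) :=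
  (Measure.infinitePi fun _ => ν).prod
    ((Measure.infinitePi fun _ => (uniformSubset m' m).toMeasure).prod alg.law)

section Run

variable {n m' : ℕ} {alg : OfflineAlgorithm n}

/-- The server's estimate in round `j` (which occupies the times `j * r, …, j * r + r - 1`) of the
value of `A`: the mean over the `m` selected agents of the local means of their `r` rewards. -/
def serverMean (m r : ℕ) (ω : Outcome n m' alg) (j : ℕ) (A : Finset (Fin n)) : ℝ :=
  (∑ i ∈ ω.2.1 j, (∑ s ∈ Finset.range r, ω.1 (i, j * r + s) A) / r) / m

/-- The queried actions (one communication round for each) and the output `Θ` of the subroutine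
when its queries are answered by the server's estimates. -/
def exploration (m r : ℕ) (ω : Outcome n m' alg) : List (Finset (Fin n)) × Finset (Fin n) :=
  (alg.program ω.2.2).transcript (serverMean m r ω) 0

/-- The number of communication rounds, that is, of queries made by the subroutine. -/
def commRounds (m r : ℕ) (ω : Outcome n m' alg) : ℕ :=
  (exploration m r ω).1.length

/-- The action played by every agent at time `t` (starting from `0`): the `j`-th queried action
during round `j`, and `Θ` once all rounds are over. -/
def action (m r : ℕ) (ω : Outcome n m' alg) (t : ℕ) : Finset (Fin n) :=
  (exploration m r ω).1.getD (t / r) (exploration m r ω).2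

/-- The cumulative `α`-regret of agent `i` over the horizon `T` against the set `S`. -/
def regret (α : ℝ) (m r T : ℕ) (S : Finset (Fin n)) (i : Fin m') (ω : Outcome n m' alg) : ℝ :=
  ∑ t ∈ Finset.range T, (α * ω.1 (i, t) S - ω.1 (i, t) (action m r ω t))

end Run

/-! ### C-MA-MAB with RandomSampling, parameters `β = 2`, `γ = 1`, `ψ = n`, `δ = 4k` -/

/-- `r_i^⋆` when the subroutine is RandomSampling. -/
def rsPlays (n k m T : ℕ) : ℕ := playsPerRound 2 n (4 * k) m T

/-- The subroutine RandomSampling, run with accuracy `ε^⋆`. -/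
def rsSubroutine (n k m T : ℕ) : OfflineAlgorithm n :=
  randomSampling n k (accuracy 2 1 n (4 * k) m T)

end

end CMAMAB

namespace CMAMAB

noncomputable section

/-! ### Submodular functions -/

/-! The algorithm explores, then commits. If `N = k(1+q)` queries are made, exploration costs at
most `N r` per agent, since rewards lie in `[0,1]`, and the commit phase costs at most `T` times the
expected gap `f(S⋆)/e - E f(Θ)`. The sample size makes `N r` of order `n r ε⁻² log T`, and this is
`T ε log T` because `ε³ = n r / T`. The gap is at most `ε + 4kξ` plus a failure probability, where
`ξ² = log T / (m r)`. The unrounded `r` is the value at which `T ε` and `4kTξ` agree, and both then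
equal the stated rate up to logarithms. The number of rounds is `N`, and `ε ≥ T^(-1/3)` because `n r
≥ 1`.

The gap needs RandomSampling to tolerate errors `ξ` in the oracle. Let `O` be the optimum padded to
`k` elements. In one iteration every element is added with probability at most `1/k`, so by
submodularity and nonnegativity `f(S⋆ ∪ S)` keeps at least the fraction `1 - 1/k` in expectation
(`avg_union_ge`). The random rank spreads its mass evenly over the top `s` marginals, so it does at
least as well as any weights in `[0,1]` of total at most `s` (`sum_selProb_mul_ge`). Comparison with
weights on `M ∩ O`, which by symmetry treat all of `O` alike, and a second moment bound for `|M ∩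
O|` give an expected gain of at least `(1-ε)/k · (f(S⋆ ∪ S) - f(S)) - 4ξ` (`avg_gain_ge`). Iterating
both estimates `k` times yields `(1-ε)(1-1/k)^(k-1) f(S⋆) - 4kξ`, and `(1-1/k)^(k-1) ≥ 1/e`
(`integral_rsLoop_ge`).

The queries are adaptive, but the set queried in round `j` depends on the rewards only through times
before that round, hence is independent of the rewards of the round. Hoeffding's inequality
therefore applies to the set actually queried, and the union bound runs over the `N` rounds instead
of over all sets. Replacing the answers by answers clipped to within `ξ` of `f` makes the
deterministic-error analysis applicable everywhere, and changes the output only on the failure event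
(`integral_output_ge`). -/

theorem IsSubmodular.union_sub_le_sum {n : ℕ} {f : Finset (Fin n) → ℝ} (hf : IsSubmodular f)
    (A B : Finset (Fin n)) : f (A ∪ B) - f A ≤ ∑ u ∈ B, (f (insert u A) - f A) := by
  induction B using Finset.induction_on with
  | empty => simp
  | insert v B hv ih =>
    rw [Finset.sum_insert hv, Finset.union_insert]
    by_cases h : v ∈ A ∪ B
    · rw [Finset.insert_eq_of_mem h]
      have hvA : v ∈ A := by simpa [hv] using h
      rw [Finset.insert_eq_of_mem hvA]
      linarith
    · have := hf A (A ∪ B) Finset.subset_union_left v h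
      linarith

/-- Adding a random element, each with probability at most `c`, to `A` loses at most the fraction
`c` of the value of a nonnegative submodular function. -/
theorem IsSubmodular.sum_mul_marginal_ge {n : ℕ} {f : Finset (Fin n) → ℝ} (hf : IsSubmodular f)
    (h0 : ∀ A, 0 ≤ f A) (A : Finset (Fin n)) (P : Fin n → ℝ) {c : ℝ} (hP0 : ∀ u, 0 ≤ P u)
    (hPc : ∀ u, P u ≤ c) (hc : 0 ≤ c) :
    -(c * f A) ≤ ∑ u, P u * (f (insert u A) - f A) := by
  classical
  -- Only elements with negative marginal can hurt. Raising their weights to `c` and dropping the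
  -- others reduces the sum to `c (f (A ∪ B) - f A)`, which is at least `-c f A`.
  set B : Finset (Fin n) := Finset.univ.filter fun u => f (insert u A) - f A < 0
  have h1 : ∑ u ∈ B, c * (f (insert u A) - f A) ≤ ∑ u, P u * (f (insert u A) - f A) := by
    rw [Finset.sum_filter]
    refine Finset.sum_le_sum fun u _ => ?_
    split_ifs with h
    · nlinarith [hPc u]
    · exact mul_nonneg (hP0 u) (not_lt.1 h)
  rw [← Finset.mul_sum] at h1
  have h2 := hf.union_sub_le_sum A B
  have h3 := h0 (A ∪ B)
  nlinarith

/-! ### Ranks -/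

section Rank

variable {n : ℕ} (M : Finset (Fin n)) (g : Fin n → ℝ)

theorem one_le_rankIn (u : Fin n) : 1 ≤ rankIn M g u := by simp [rankIn]

/-- Larger value first, then smaller index, is a strict total order; by transitivity the
predecessors of `u` are among those of `v`, which also include `u` itself. -/
theorem rankIn_lt {u v : Fin n} (hu : u ∈ M) (h : g v < g u ∨ (g u = g v ∧ u < v)) :
    rankIn M g u < rankIn M g v := by
  classical
  unfold rankIn
  refine Nat.succ_lt_succ (Finset.card_lt_card ?_)
  rw [Finset.ssubset_iff_of_subset]
  · refine ⟨u, ?_, ?_⟩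
    · simp only [Finset.mem_filter]; exact ⟨hu, h⟩
    · simp
  · intro w
    simp only [Finset.mem_filter]
    rintro ⟨hw, h'⟩
    refine ⟨hw, ?_⟩
    rcases h with h | ⟨h, h2⟩ <;> rcases h' with h' | ⟨h', h3⟩
    · left; linarith
    · left; linarith
    · left; linarith
    · right; exact ⟨by linarith, h3.trans h2⟩

theorem rankIn_injOn : Set.InjOn (rankIn M g) M := by
  intro u hu v hv h
  by_contra hne
  rcases lt_trichotomy (g u) (g v) with h1 | h1 | h1
  · exact absurd h (rankIn_lt M g hv (Or.inl h1)).ne'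
  · rcases lt_or_gt_of_ne hne with h2 | h2
    · exact absurd h (rankIn_lt M g hu (Or.inr ⟨h1, h2⟩)).ne
    · exact absurd h (rankIn_lt M g hv (Or.inr ⟨h1.symm, h2⟩)).ne'
  · exact absurd h (rankIn_lt M g hu (Or.inl h1)).ne

theorem rankIn_le_card {u : Fin n} (hu : u ∈ M) : rankIn M g u ≤ M.card := by
  classical
  unfold rankIn
  refine Nat.succ_le_of_lt (Finset.card_lt_card ?_)
  rw [Finset.ssubset_iff_of_subset (Finset.filter_subset _ _)]
  exact ⟨u, hu, by simp⟩

theorem exists_rankIn_eq {c : ℕ} (h1 : 1 ≤ c) (h2 : c ≤ M.card) : ∃ u ∈ M, rankIn M g u = c := by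
  classical
  have himg : M.image (rankIn M g) = Finset.Icc 1 M.card := by
    refine Finset.eq_of_subset_of_card_le ?_ ?_
    · intro x hx
      obtain ⟨u, hu, rfl⟩ := Finset.mem_image.1 hx
      exact Finset.mem_Icc.2 ⟨one_le_rankIn M g u, rankIn_le_card M g hu⟩
    · rw [Finset.card_image_of_injOn (rankIn_injOn M g)]
      simp
  have : c ∈ M.image (rankIn M g) := by rw [himg]; exact Finset.mem_Icc.2 ⟨h1, h2⟩
  simpa using this

theorem le_of_rankIn_le {u v : Fin n} (h : rankIn M g u ≤ rankIn M g v) :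
    v ∈ M → g v ≤ g u := by
  intro hv
  by_contra hlt
  exact absurd (rankIn_lt M g hv (Or.inl (not_le.1 hlt))) (not_lt.2 h)

theorem rsUpdate_of_rank {u : Fin n} {d : ℝ} (hu : u ∈ M) (h : rankIn M g u = ⌈d⌉₊)
    (S : Finset (Fin n)) : rsUpdate M d g S = if 0 ≤ g u then insert u S else S := by
  classical
  have key : (M.filter fun v => rankIn M g v = ⌈d⌉₊ ∧ 0 ≤ g v) =
      if 0 ≤ g u then {u} else ∅ := by
    ext v
    split_ifs with h0
    · simp only [Finset.mem_filter, Finset.mem_singleton]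
      constructor
      · rintro ⟨hv, h1, -⟩
        exact rankIn_injOn M g hv hu (h1.trans h.symm)
      · rintro rfl
        exact ⟨hu, h, h0⟩
    · simp only [Finset.mem_filter, Finset.notMem_empty, iff_false]
      rintro ⟨hv, h1, h2⟩
      rw [rankIn_injOn M g hv hu (h1.trans h.symm)] at h2
      exact h0 h2
  unfold rsUpdate
  convert congrArg (S ∪ ·) key using 1
  split_ifs <;> simp

theorem rsUpdate_cases (d : ℝ) (S : Finset (Fin n)) :
    rsUpdate M d g S = S ∨ ∃ u ∈ M, rankIn M g u = ⌈d⌉₊ ∧ rsUpdate M d g S = insert u S := by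
  classical
  by_cases h : ∃ u ∈ M, rankIn M g u = ⌈d⌉₊
  · obtain ⟨u, hu, hr⟩ := h
    rw [rsUpdate_of_rank M g hu hr]
    split_ifs
    · exact Or.inr ⟨u, hu, hr, rfl⟩
    · exact Or.inl rfl
  · left
    push Not at h
    unfold rsUpdate
    rw [Finset.filter_false_of_mem]
    · simp
    · intro v hv h'
      exact h v hv h'.1

theorem card_rsUpdate_le (d : ℝ) (S : Finset (Fin n)) :
    (rsUpdate M d g S).card ≤ S.card + 1 := by
  rcases rsUpdate_cases M g d S with h | ⟨u, -, -, h⟩ <;> rw [h]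
  · omega
  · exact Finset.card_insert_le _ _

end Rank

/-! ### One random choice of the rank -/

section Selection

variable {n : ℕ} (M : Finset (Fin n)) (g : Fin n → ℝ) (s : ℝ)

/-- The probability that the element `u` has the rank drawn by RandomSampling. -/
def selProb (u : Fin n) : ℝ := uniformUnit.real {U | rankIn M g u = ⌈s * U⌉₊}

theorem measurableSet_rank_eq (c : ℕ) : MeasurableSet {U : ℝ | c = ⌈s * U⌉₊} :=
  measurableSet_eq_fun measurable_const (Nat.measurable_ceil.comp (measurable_const_mul s))

theorem selProb_nonneg (u : Fin n) : 0 ≤ selProb M g s u := measureReal_nonneg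

/-- Ranks are distinct on `M`, so at most one indicator is nonzero. This makes any functional of the
updated set linear in the indicators; it is used for `f` and for `A ↦ f (O ∪ A)`. -/
theorem rsUpdate_apply_eq (U : ℝ) (S : Finset (Fin n)) (Φ : Finset (Fin n) → ℝ) :
    Φ (rsUpdate M (s * U) g S) = Φ S + ∑ u ∈ M,
      {U | rankIn M g u = ⌈s * U⌉₊}.indicator (fun _ => (1 : ℝ)) U *
        (if 0 ≤ g u then Φ (insert u S) - Φ S else 0) := by
  classical
  by_cases h : ∃ u ∈ M, rankIn M g u = ⌈s * U⌉₊
  · obtain ⟨u, hu, hr⟩ := h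
    rw [rsUpdate_of_rank M g hu hr, Finset.sum_eq_single_of_mem u hu]
    · rw [Set.indicator_of_mem (by exact hr)]
      split_ifs <;> ring
    · intro v hv hne
      rw [Set.indicator_of_notMem, zero_mul]
      intro h'
      exact hne (rankIn_injOn M g hv hu (Eq.trans h' hr.symm))
  · push Not at h
    rw [Finset.sum_eq_zero, add_zero]
    · rcases rsUpdate_cases M g (s * U) S with h' | ⟨u, hu, hr, -⟩
      · rw [h']
      · exact absurd hr (h u hu)
    · intro v hv
      rw [Set.indicator_of_notMem, zero_mul]
      exact h v hv

theorem integrable_rank_indicator (c : ℕ) :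
    Integrable ({U : ℝ | c = ⌈s * U⌉₊}.indicator fun _ => (1 : ℝ)) uniformUnit :=
  (integrable_const 1).indicator (measurableSet_rank_eq s c)

theorem integral_rsUpdate (S : Finset (Fin n)) (Φ : Finset (Fin n) → ℝ) :
    ∫ U, Φ (rsUpdate M (s * U) g S) ∂uniformUnit = Φ S + ∑ u ∈ M,
      selProb M g s u * (if 0 ≤ g u then Φ (insert u S) - Φ S else 0) := by
  simp_rw [rsUpdate_apply_eq M g s _ S Φ]
  rw [integral_add (integrable_const _)
    (integrable_finsetSum _ fun u _ => (integrable_rank_indicator s _).mul_const _)]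
  rw [integral_finsetSum _ fun u _ => (integrable_rank_indicator s _).mul_const _]
  congr 1
  · simp
  · refine Finset.sum_congr rfl fun u _ => ?_
    rw [integral_mul_const, integral_indicator_const _ (measurableSet_rank_eq s _)]
    simp [selProb]

theorem ae_uniformUnit : ∀ᵐ U ∂uniformUnit, U ∈ Set.Ioc (0 : ℝ) 1 :=
  ae_restrict_mem measurableSet_Ioc

variable {s}

/-- For `U ∈ (0,1]` the drawn rank `⌈s U⌉` lies between `1` and `|M|`, hence is attained by exactly
one element. -/
theorem sum_selProb (hs : 0 < s) (hM : s ≤ M.card) : ∑ u ∈ M, selProb M g s u = 1 := by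
  have h1 : ∫ U, (∑ u ∈ M, {U | rankIn M g u = ⌈s * U⌉₊}.indicator (fun _ => (1 : ℝ)) U)
      ∂uniformUnit = ∑ u ∈ M, selProb M g s u := by
    rw [integral_finsetSum _ fun u _ => integrable_rank_indicator s _]
    refine Finset.sum_congr rfl fun u _ => ?_
    rw [integral_indicator_const _ (measurableSet_rank_eq s _)]
    simp [selProb]
  rw [← h1]
  have h2 : ∀ᵐ U ∂uniformUnit,
      ∑ u ∈ M, {U | rankIn M g u = ⌈s * U⌉₊}.indicator (fun _ => (1 : ℝ)) U = 1 := by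
    filter_upwards [ae_uniformUnit] with U hU
    obtain ⟨u, hu, hr⟩ := exists_rankIn_eq M g (c := ⌈s * U⌉₊)
      (Nat.one_le_ceil_iff.2 (mul_pos hs hU.1))
      (Nat.ceil_le.2 (le_trans (by nlinarith [hU.2]) hM))
    rw [Finset.sum_eq_single_of_mem u hu, Set.indicator_of_mem (by exact hr)]
    intro v hv hne
    rw [Set.indicator_of_notMem]
    intro h'
    exact hne (rankIn_injOn M g hv hu (Eq.trans h' hr.symm))
  rw [integral_congr_ae h2]
  simp

theorem uniformUnit_real_Ioc {a b : ℝ} (ha : 0 ≤ a) (hab : a ≤ b) (hb : b ≤ 1) :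
    uniformUnit.real (Set.Ioc a b) = b - a := by
  unfold uniformUnit
  rw [measureReal_restrict_apply measurableSet_Ioc,
    Set.inter_eq_left.2 (Set.Ioc_subset_Ioc ha hb), Real.volume_real_Ioc_of_le hab]

/-- Each rank is drawn on an interval of length `1/s`. Intersecting with `(0,1]` leaves it whole for
ranks up to `s` and empties it for ranks from `s + 1` on, so only the rank `⌈s⌉` can have an
intermediate probability. -/
theorem rank_set_eq (hs : 0 < s) {c : ℕ} (hc : 1 ≤ c) :
    {U : ℝ | c = ⌈s * U⌉₊} = Set.Ioc (((c : ℝ) - 1) / s) (c / s) := by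
  ext U
  simp only [Set.mem_ofPred_eq, Set.mem_Ioc]
  rw [eq_comm, Nat.ceil_eq_iff (by omega), div_lt_iff₀' hs, le_div_iff₀' hs]
  push_cast [Nat.cast_sub hc]
  rfl

theorem selProb_le (hs : 0 < s) (u : Fin n) : selProb M g s u ≤ 1 / s := by
  unfold selProb
  rw [rank_set_eq hs (one_le_rankIn M g u)]
  unfold uniformUnit
  rw [measureReal_restrict_apply measurableSet_Ioc]
  refine (measureReal_mono Set.inter_subset_left (by simp)).trans ?_
  rw [Real.volume_real_Ioc_of_le (by gcongr; linarith)]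
  apply le_of_eq
  ring

theorem selProb_of_lt (hs : 0 < s) {u : Fin n} (h : (rankIn M g u : ℝ) ≤ s) :
    selProb M g s u = 1 / s := by
  unfold selProb
  have h1 : (1 : ℝ) ≤ rankIn M g u := by exact_mod_cast one_le_rankIn M g u
  rw [rank_set_eq hs (one_le_rankIn M g u), uniformUnit_real_Ioc]
  · ring
  · exact div_nonneg (by linarith) hs.le
  · gcongr; linarith
  · rwa [div_le_one hs]

theorem selProb_of_gt (hs : 0 < s) {u : Fin n} (h : s ≤ (rankIn M g u : ℝ) - 1) :
    selProb M g s u = 0 := by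
  unfold selProb
  rw [rank_set_eq hs (one_le_rankIn M g u)]
  unfold uniformUnit
  rw [measureReal_restrict_apply measurableSet_Ioc]
  have : Set.Ioc (((rankIn M g u : ℝ) - 1) / s) (rankIn M g u / s) ∩ Set.Ioc 0 1 = ∅ := by
    ext U
    simp only [Set.mem_inter_iff, Set.mem_Ioc, Set.mem_empty_iff_false, iff_false]
    rintro ⟨⟨h1, -⟩, -, h2⟩
    rw [div_lt_iff₀' hs] at h1
    nlinarith
  simp [this]

/-- The selection by rank is at least as good as any fractional selection of total weight `s`. -/
theorem sum_selProb_mul_ge (hs : 0 < s) (hM : s ≤ M.card) {h : Fin n → ℝ} (h0 : ∀ u, 0 ≤ h u)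
    (hh : ∀ u v, g u ≤ g v → h u ≤ h v) {w : Fin n → ℝ} (hw0 : ∀ u, 0 ≤ w u) (hw1 : ∀ u, w u ≤ 1)
    (hws : ∑ u ∈ M, w u ≤ s) :
    1 / s * ∑ u ∈ M, w u * h u ≤ ∑ u ∈ M, selProb M g s u * h u := by
  -- Exchange argument around the threshold element `v` of rank `⌈s⌉`: before it the selection has
  -- the maximal weight `1/s` and `h u ≥ h v`, after it weight `0` and `h u ≤ h v`. Subtracting `h
  -- v` thus makes every term nonnegative.
  obtain ⟨v, hv, hr⟩ := exists_rankIn_eq M g (c := ⌈s⌉₊) (Nat.one_le_ceil_iff.2 hs)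
    (Nat.ceil_le.2 hM)
  have hpt : ∀ u ∈ M, 0 ≤ (selProb M g s u - 1 / s * w u) * (h u - h v) := by
    intro u hu
    have hs' : 0 < 1 / s := by positivity
    rcases lt_trichotomy (rankIn M g u) (rankIn M g v) with hlt | heq | hgt
    · rw [hr, Nat.lt_ceil] at hlt
      rw [selProb_of_lt M g hs hlt.le]
      refine mul_nonneg ?_ ?_
      · nlinarith [hw1 u]
      · have := hh v u (le_of_rankIn_le M g (by rw [hr]; exact (Nat.lt_ceil.2 hlt).le) hv)
        linarith
    · rw [rankIn_injOn M g hu hv heq]; simp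
    · rw [selProb_of_gt M g hs]
      · refine mul_nonneg_of_nonpos_of_nonpos ?_ ?_
        · have := mul_nonneg hs'.le (hw0 u); linarith
        · have := hh u v (le_of_rankIn_le M g hgt.le hu)
          linarith
      · have h1 : ⌈s⌉₊ + 1 ≤ rankIn M g u := by rw [← hr]; exact hgt
        have h2 : (⌈s⌉₊ : ℝ) + 1 ≤ rankIn M g u := by exact_mod_cast h1
        linarith [Nat.le_ceil s]
  have hsum := Finset.sum_nonneg hpt
  have hexp : ∑ u ∈ M, (selProb M g s u - 1 / s * w u) * (h u - h v) =
      ∑ u ∈ M, selProb M g s u * h u - 1 / s * ∑ u ∈ M, w u * h u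
        - h v * (∑ u ∈ M, selProb M g s u - 1 / s * ∑ u ∈ M, w u) := by
    rw [mul_sub, Finset.mul_sum, Finset.mul_sum, Finset.mul_sum, Finset.mul_sum,
      ← Finset.sum_sub_distrib, ← Finset.sum_sub_distrib, ← Finset.sum_sub_distrib]
    refine Finset.sum_congr rfl fun u _ => ?_
    ring
  rw [hexp, sum_selProb M g hs hM] at hsum
  have h3 : 1 / s * ∑ u ∈ M, w u ≤ 1 := by
    rw [one_div, inv_mul_le_iff₀ hs]; linarith
  nlinarith [h0 v]

end Selection

/-! ### Averages over the subsets of a given size -/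

section Average

variable {n : ℕ} (q : ℕ)

/-- The average of `φ` over the subsets of `Fin n` with `q` elements. -/
def subsetAvg (φ : Finset (Fin n) → ℝ) : ℝ :=
  (Finset.powersetCard q (Finset.univ : Finset (Fin n))).expect φ

variable {q}

theorem powersetCard_univ_nonempty (hq : q ≤ n) :
    (Finset.powersetCard q (Finset.univ : Finset (Fin n))).Nonempty :=
  Finset.powersetCard_nonempty.2 (by simpa using hq)

theorem integral_uniformSubset (hq : q ≤ n) (φ : Finset (Fin n) → ℝ) :
    ∫ M, φ M ∂(uniformSubset n q).toMeasure = subsetAvg q φ := by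
  rw [PMF.integral_eq_sum]
  unfold uniformSubset subsetAvg
  rw [dif_pos (powersetCard_univ_nonempty hq), Finset.expect_eq_sum_div_card, Finset.sum_div]
  simp only [PMF.uniformOfFinset_apply, smul_eq_mul]
  rw [← Finset.sum_subset (Finset.subset_univ
    (Finset.powersetCard q (Finset.univ : Finset (Fin n))))]
  · refine Finset.sum_congr rfl fun M hM => ?_
    rw [if_pos hM, ENNReal.toReal_inv, ENNReal.toReal_natCast]
    ring
  · intro M _ hM
    rw [if_neg hM]; simp

theorem ae_card_uniformSubset (hq : q ≤ n) :
    ∀ᵐ M ∂(uniformSubset n q).toMeasure, M.card = q := by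
  rw [ae_iff]
  rw [PMF.toMeasure_apply_eq_zero_iff _ (Set.toFinite _).measurableSet]
  unfold uniformSubset
  rw [dif_pos (powersetCard_univ_nonempty hq), PMF.support_uniformOfFinset]
  rw [Set.disjoint_left]
  intro M hM hM'
  exact hM' (by simpa using hM)

theorem subsetAvg_mono {φ ψ : Finset (Fin n) → ℝ} (h : ∀ M, M.card = q → φ M ≤ ψ M) :
    subsetAvg q φ ≤ subsetAvg q ψ :=
  Finset.expect_le_expect fun M hM => h M (Finset.mem_powersetCard.1 hM).2

theorem subsetAvg_congr {φ ψ : Finset (Fin n) → ℝ} (h : ∀ M, M.card = q → φ M = ψ M) :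
    subsetAvg q φ = subsetAvg q ψ :=
  Finset.expect_congr rfl fun M hM => h M (Finset.mem_powersetCard.1 hM).2

theorem subsetAvg_add (φ ψ : Finset (Fin n) → ℝ) :
    subsetAvg q (fun M => φ M + ψ M) = subsetAvg q φ + subsetAvg q ψ :=
  Finset.expect_add_distrib _ _ _

theorem subsetAvg_sub (φ ψ : Finset (Fin n) → ℝ) :
    subsetAvg q (fun M => φ M - ψ M) = subsetAvg q φ - subsetAvg q ψ :=
  Finset.expect_sub_distrib _ _ _

theorem subsetAvg_const_mul (c : ℝ) (φ : Finset (Fin n) → ℝ) :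
    subsetAvg q (fun M => c * φ M) = c * subsetAvg q φ :=
  (Finset.mul_expect _ _ _).symm

theorem subsetAvg_sum {ι : Type*} (s : Finset ι) (φ : ι → Finset (Fin n) → ℝ) :
    subsetAvg q (fun M => ∑ i ∈ s, φ i M) = ∑ i ∈ s, subsetAvg q (φ i) :=
  Finset.expect_sum_comm _ _ _

theorem subsetAvg_const (hq : q ≤ n) (c : ℝ) : subsetAvg (n := n) q (fun _ => c) = c :=
  Finset.expect_const (powersetCard_univ_nonempty hq) c

theorem subsetAvg_map (e : Equiv.Perm (Fin n)) (φ : Finset (Fin n) → ℝ) :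
    subsetAvg q (fun M => φ (M.map e.toEmbedding)) = subsetAvg q φ := by
  unfold subsetAvg
  refine Finset.expect_nbij' (fun M => M.map e.toEmbedding) (fun M => M.map e.symm.toEmbedding)
    ?_ ?_ ?_ ?_ ?_
  · intro M hM; simpa [Finset.mem_powersetCard] using hM
  · intro M hM; simpa [Finset.mem_powersetCard] using hM
  · intro M _; ext; simp
  · intro M _; ext; simp
  · intro M _; rfl

/-- The indicator of `u ∈ M` as a real number. -/
def mem01 (M : Finset (Fin n)) (u : Fin n) : ℝ := if u ∈ M then 1 else 0

theorem mem01_map (e : Equiv.Perm (Fin n)) (M : Finset (Fin n)) (u : Fin n) :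
    mem01 (M.map e.toEmbedding) (e u) = mem01 M u := by
  simp [mem01]

theorem sum_mem01 (O M : Finset (Fin n)) : ∑ u ∈ O, mem01 M u = ((M ∩ O).card : ℝ) := by
  simp [mem01, Finset.sum_ite_mem, Finset.inter_comm]

theorem mem01_mul_self (M : Finset (Fin n)) (u : Fin n) : mem01 M u * mem01 M u = mem01 M u := by
  unfold mem01; split_ifs <;> simp

theorem mem01_nonneg (M : Finset (Fin n)) (u : Fin n) : 0 ≤ mem01 M u := by
  unfold mem01; split_ifs <;> simp

theorem sum_mem01_univ {M : Finset (Fin n)} (hM : M.card = q) : ∑ u, mem01 M u = q := by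
  rw [sum_mem01]; simp [hM]

/-- All elements are exchangeable and the `n` equal averages add up to `q`. -/
theorem subsetAvg_mem01 (hq : q ≤ n) (u : Fin n) :
    subsetAvg q (fun M => mem01 M u) = (q : ℝ) / n := by
  have hn : (0 : ℝ) < n := by exact_mod_cast u.pos
  have hsym : ∀ v : Fin n, subsetAvg q (fun M => mem01 M v) = subsetAvg q (fun M => mem01 M u) := by
    intro v
    rw [← subsetAvg_map (Equiv.swap u v) (fun M => mem01 M v)]
    refine subsetAvg_congr fun M _ => ?_
    have := mem01_map (Equiv.swap u v) M u
    rwa [Equiv.swap_apply_left] at this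
  have h1 : subsetAvg q (fun M : Finset (Fin n) => ∑ v, mem01 M v) = q := by
    rw [subsetAvg_congr (fun M hM => sum_mem01_univ hM), subsetAvg_const hq]
  rw [subsetAvg_sum, Finset.sum_congr rfl fun v _ => hsym v] at h1
  simp only [Finset.sum_const, Finset.card_univ, Fintype.card_fin, nsmul_eq_mul] at h1
  field_simp
  linarith

/-- Sampling without replacement is negatively correlated: by symmetry the exact value is
`q(q-1)/(n(n-1))`. -/
theorem subsetAvg_mem01_mul_le (hq : q ≤ n) {u v : Fin n} (huv : u ≠ v) :
    subsetAvg q (fun M => mem01 M u * mem01 M v) ≤ ((q : ℝ) / n) ^ 2 := by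
  classical
  have hn1 : 1 < n := by
    have := u.2; have := v.2
    have : (u : ℕ) ≠ v := fun h => huv (Fin.ext h)
    omega
  have hn : (1 : ℝ) < n := by exact_mod_cast hn1
  have hsym : ∀ w ∈ Finset.univ.erase u, subsetAvg q (fun M => mem01 M u * mem01 M w) =
      subsetAvg q (fun M => mem01 M u * mem01 M v) := by
    intro w hw
    have hwu : w ≠ u := (Finset.mem_erase.1 hw).1
    rw [← subsetAvg_map (Equiv.swap v w) (fun M => mem01 M u * mem01 M w)]
    refine subsetAvg_congr fun M _ => ?_
    have h1 := mem01_map (Equiv.swap v w) M v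
    have h2 := mem01_map (Equiv.swap v w) M u
    rw [Equiv.swap_apply_left] at h1
    rw [Equiv.swap_apply_of_ne_of_ne huv hwu.symm] at h2
    rw [h1, h2]
  have h1 : subsetAvg q (fun M => ∑ w, mem01 M u * mem01 M w) = q * (q / n) := by
    rw [subsetAvg_congr (ψ := fun M => q * mem01 M u), subsetAvg_const_mul, subsetAvg_mem01 hq]
    intro M hM
    rw [← Finset.mul_sum, sum_mem01_univ hM, mul_comm]
  rw [subsetAvg_sum, ← Finset.add_sum_erase _ _ (Finset.mem_univ u),
    Finset.sum_congr rfl hsym] at h1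
  simp only [mem01_mul_self, subsetAvg_mem01 hq, Finset.sum_const, nsmul_eq_mul,
    Finset.card_erase_of_mem (Finset.mem_univ u), Finset.card_univ, Fintype.card_fin] at h1
  rw [Nat.cast_sub hn1.le, Nat.cast_one] at h1
  set P := subsetAvg q (fun M => mem01 M u * mem01 M v)
  have hq' : (q : ℝ) ≤ n := by exact_mod_cast hq
  have hq0 : (0 : ℝ) ≤ q := q.cast_nonneg
  have h2 : (n - 1 : ℝ) * P = q * (q - 1) / n := by
    have : (n - 1 : ℝ) * P = q * (q / n) - q / n := by linarith
    rw [this]; ring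
  have h3 : P = q * (q - 1) / n / (n - 1) := by
    rw [← h2]; field_simp [(by linarith : (n : ℝ) - 1 ≠ 0)]
  rw [h3, div_pow, div_div, div_le_div_iff₀ (by nlinarith) (by nlinarith)]
  have : 0 ≤ (q : ℝ) * n * (n - q) := by
    apply mul_nonneg (by positivity); linarith
  nlinarith

/-! ### Overlap of a uniform `q`-subset with a fixed `k`-subset. -/

variable {k : ℕ} {O : Finset (Fin n)}

theorem subsetAvg_card_inter (hq : q ≤ n) (hO : O.card = k) :
    subsetAvg q (fun M => ((M ∩ O).card : ℝ)) = k * q / n := by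
  simp_rw [← sum_mem01]
  rw [subsetAvg_sum, Finset.sum_congr rfl fun u _ => subsetAvg_mem01 hq u]
  simp [hO]; ring

theorem subsetAvg_card_inter_sq_le (hq : q ≤ n) (hO : O.card = k) :
    subsetAvg q (fun M => ((M ∩ O).card : ℝ) ^ 2) ≤ (k * q / n : ℝ) ^ 2 + k * q / n := by
  classical
  have h1 : ∀ M : Finset (Fin n), ((M ∩ O).card : ℝ) ^ 2 =
      ∑ u ∈ O, ∑ v ∈ O, mem01 M u * mem01 M v := by
    intro M
    rw [sq, ← sum_mem01, Finset.sum_mul_sum]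
  simp_rw [h1]
  rw [subsetAvg_sum, Finset.sum_congr rfl fun u _ => subsetAvg_sum O _]
  have h2 : ∀ u ∈ O, ∑ v ∈ O, subsetAvg q (fun M => mem01 M u * mem01 M v) ≤
      k * ((q : ℝ) / n) ^ 2 + q / n := by
    intro u hu
    rw [← Finset.add_sum_erase _ _ hu]
    simp only [mem01_mul_self, subsetAvg_mem01 hq]
    have : ∑ v ∈ O.erase u, subsetAvg q (fun M => mem01 M u * mem01 M v) ≤
        ∑ v ∈ O, ((q : ℝ) / n) ^ 2 := by
      refine (Finset.sum_le_sum fun v hv => subsetAvg_mem01_mul_le hq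
        (Finset.ne_of_mem_erase hv).symm).trans ?_
      exact Finset.sum_le_sum_of_subset_of_nonneg (Finset.erase_subset _ _)
        fun _ _ _ => by positivity
    simp only [Finset.sum_const, hO, nsmul_eq_mul] at this
    linarith
  refine (Finset.sum_le_sum h2).trans (le_of_eq ?_)
  simp only [Finset.sum_const, hO, nsmul_eq_mul]
  ring

/-- With `x = |M ∩ O|`, the positive part of `x - s` is at most `(x - s + c)² / (4c)` for every `c >
0`. The overlap has mean `s` and variance at most `s`, so `c = √s` gives an expected loss of at most
`2s / (4√s) = √s / 2`. -/
theorem subsetAvg_min_ge (hq : q ≤ n) (hO : O.card = k) {s : ℝ} (hs : s = k * q / n)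
    (hs0 : 0 < s) :
    s - √s / 2 ≤ subsetAvg q (fun M => min ((M ∩ O).card : ℝ) s) := by
  have hc : 0 < √s := Real.sqrt_pos.2 hs0
  have hcs : √s * √s = s := Real.mul_self_sqrt hs0.le
  have hpt : ∀ M : Finset (Fin n), (M.card = q) →
      ((M ∩ O).card : ℝ) - 1 / (4 * √s) * (((M ∩ O).card : ℝ) ^ 2 +
        ((2 * √s - 2 * s) * ((M ∩ O).card : ℝ) + (√s - s) ^ 2)) ≤
        min ((M ∩ O).card : ℝ) s := by
    intro M _
    set x := ((M ∩ O).card : ℝ)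
    have h4 : 0 < 1 / (4 * √s) := by positivity
    have e : x ^ 2 + ((2 * √s - 2 * s) * x + (√s - s) ^ 2) = (x - s + √s) ^ 2 := by ring
    rw [e]
    refine le_min ?_ ?_
    · have := mul_nonneg h4.le (sq_nonneg (x - s + √s)); linarith
    · have : x - s ≤ 1 / (4 * √s) * (x - s + √s) ^ 2 := by
        rw [one_div, ← div_eq_inv_mul, le_div_iff₀ (by positivity)]
        nlinarith [sq_nonneg (x - s - √s)]
      linarith
  refine le_trans ?_ (subsetAvg_mono hpt)
  rw [subsetAvg_sub, subsetAvg_const_mul, subsetAvg_add, subsetAvg_add, subsetAvg_const_mul,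
    subsetAvg_const hq, subsetAvg_card_inter hq hO, ← hs]
  have h2 := subsetAvg_card_inter_sq_le hq hO
  rw [← hs] at h2
  have h4 : 0 < 1 / (4 * √s) := by positivity
  have h5 : subsetAvg q (fun M => ((M ∩ O).card : ℝ) ^ 2) +
      ((2 * √s - 2 * s) * s + (√s - s) ^ 2) ≤ 2 * s := by nlinarith
  have h6 := mul_le_mul_of_nonneg_left h5 h4.le
  have h7 : 1 / (4 * √s) * (2 * s) = √s / 2 := by
    nth_rewrite 2 [← hcs]; field_simp; ring
  linarith

/-- The weights `min 1 (s / |M ∩ O|)` on `M ∩ O`. -/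
def capWeight (O : Finset (Fin n)) (s : ℝ) (M : Finset (Fin n)) (u : Fin n) : ℝ :=
  mem01 O u * min 1 (s / (M ∩ O).card)

theorem capWeight_nonneg {s : ℝ} (hs : 0 ≤ s) (M : Finset (Fin n)) (u : Fin n) :
    0 ≤ capWeight O s M u :=
  mul_nonneg (mem01_nonneg _ _) (le_min zero_le_one (by positivity))

theorem capWeight_le_one (s : ℝ) (M : Finset (Fin n)) (u : Fin n) :
    capWeight O s M u ≤ 1 := by
  unfold capWeight mem01
  split_ifs
  · simp
  · simp

theorem sum_capWeight {s : ℝ} (hs : 0 ≤ s) (M : Finset (Fin n)) :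
    ∑ u ∈ M, capWeight O s M u = min ((M ∩ O).card : ℝ) s := by
  unfold capWeight
  rw [← Finset.sum_mul, sum_mem01, Finset.inter_comm]
  rcases Nat.eq_zero_or_pos (M ∩ O).card with h | h
  · simp [h, hs]
  · have : (0 : ℝ) < (M ∩ O).card := by exact_mod_cast h
    rw [mul_min_of_nonneg _ _ this.le]
    congr 1
    · simp
    · field_simp

/-- A transposition of two elements of `O` preserves `|M ∩ O|`, so every element of `O` receives the
same average weight, a `k`-th of the total. This is why the comparison set must have exactly `k`
elements. -/
theorem subsetAvg_capWeight {s : ℝ} (hs : 0 ≤ s) (hO : O.card = k) {u : Fin n} (hu : u ∈ O) :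
    subsetAvg q (fun M => mem01 M u * capWeight O s M u) =
      subsetAvg q (fun M => min ((M ∩ O).card : ℝ) s) / k := by
  have hsym : ∀ v ∈ O, subsetAvg q (fun M => mem01 M v * capWeight O s M v) =
      subsetAvg q (fun M => mem01 M u * capWeight O s M u) := by
    intro v hv
    rw [← subsetAvg_map (Equiv.swap u v)]
    refine subsetAvg_congr fun M _ => ?_
    have h1 := mem01_map (Equiv.swap u v) M u
    rw [Equiv.swap_apply_left] at h1
    have h2 : (M.map (Equiv.swap u v).toEmbedding ∩ O).card = (M ∩ O).card := by
      have hOe : O.map (Equiv.swap u v).toEmbedding = O := by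
        refine Finset.eq_of_subset_of_card_le ?_ (by simp)
        intro w hw
        obtain ⟨x, hx, rfl⟩ := Finset.mem_map.1 hw
        simp only [Equiv.coe_toEmbedding, Equiv.swap_apply_def]
        split_ifs <;> assumption
      nth_rewrite 1 [← hOe]
      rw [← Finset.map_inter, Finset.card_map]
    unfold capWeight
    rw [h1, h2]
    simp [mem01, hu, hv]
  have hk : (k : ℝ) ≠ 0 := by
    rw [← hO]; exact_mod_cast (Finset.card_pos.2 ⟨u, hu⟩).ne'
  have h1 : ∑ v ∈ O, subsetAvg q (fun M => mem01 M v * capWeight O s M v) =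
      subsetAvg q (fun M => min ((M ∩ O).card : ℝ) s) := by
    rw [← subsetAvg_sum]
    refine subsetAvg_congr fun M _ => ?_
    rw [← sum_capWeight hs]
    simp only [mem01, ite_mul, one_mul, zero_mul]
    rw [Finset.sum_ite_mem]
    refine Finset.sum_subset Finset.inter_subset_right ?_
    intro v hv hv'
    have : v ∉ O := fun h => hv' (Finset.mem_inter.2 ⟨h, hv⟩)
    simp [capWeight, mem01, this]
  rw [Finset.sum_congr rfl hsym] at h1
  simp only [Finset.sum_const, hO, nsmul_eq_mul] at h1
  rw [← h1]; field_simp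

end Average

/-! ### The transcript of RandomSampling -/

section Transcript

variable {n : ℕ} (ans : ℕ → Finset (Fin n) → ℝ)

/-- The answers recorded by `queryEach` started with the query number `j`. -/
def recordAnswers (S : Finset (Fin n)) :
    List (Fin n) → (Fin n → ℝ) → ℕ → (Fin n → ℝ)
  | [], b, _ => b
  | u :: l, b, j => recordAnswers S l (Function.update b u (ans j (insert u S))) (j + 1)

/-- The marginals estimated by one iteration of RandomSampling which starts at query `j`. -/
def estMarginal (M S : Finset (Fin n)) (j : ℕ) (u : Fin n) : ℝ :=
  recordAnswers ans S (M.sort (· ≤ ·)) 0 (j + 1) u - ans j S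

theorem transcript_queryEach (S : Finset (Fin n)) (l : List (Fin n)) (b : Fin n → ℝ)
    (cont : (Fin n → ℝ) → QueryProgram n) (j : ℕ) :
    (queryEach S l b cont).transcript ans j =
      (l.map (fun u => insert u S) ++
        ((cont (recordAnswers ans S l b j)).transcript ans (j + l.length)).1,
        ((cont (recordAnswers ans S l b j)).transcript ans (j + l.length)).2) := by
  induction l generalizing b j with
  | nil => simp [queryEach, recordAnswers]
  | cons u l ih =>
    simp only [queryEach, QueryProgram.transcript, ih, recordAnswers, List.map_cons,
      List.cons_append, List.length_cons]
    rw [show j + 1 + l.length = j + (l.length + 1) by ring]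

theorem transcript_rsLoop_cons (s : ℝ) (M : Finset (Fin n)) (U : ℝ)
    (l : List (Finset (Fin n) × ℝ)) (S : Finset (Fin n)) (j : ℕ) :
    (rsLoop s ((M, U) :: l) S).transcript ans j =
      (S :: ((M.sort (· ≤ ·)).map (fun u => insert u S) ++
        ((rsLoop s l (rsUpdate M (s * U) (estMarginal ans M S j) S)).transcript ans
          (j + 1 + M.card)).1),
        ((rsLoop s l (rsUpdate M (s * U) (estMarginal ans M S j) S)).transcript ans
          (j + 1 + M.card)).2) := by
  simp only [rsLoop, QueryProgram.transcript, transcript_queryEach, Finset.length_sort]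
  rfl

/-- The disjunction in `hu` is the induction invariant: the entry of `u` is still to be written or
is already accurate. -/
theorem recordAnswers_close {f : Finset (Fin n) → ℝ} {ξ : ℝ}
    (h : ∀ j A, |ans j A - f A| ≤ ξ) (S : Finset (Fin n)) (l : List (Fin n)) (b : Fin n → ℝ)
    (j : ℕ) (u : Fin n) (hu : u ∈ l ∨ |b u - f (insert u S)| ≤ ξ) :
    |recordAnswers ans S l b j u - f (insert u S)| ≤ ξ := by
  induction l generalizing b j with
  | nil => simpa [recordAnswers] using hu
  | cons v l ih =>
    refine ih _ _ ?_
    by_cases huv : u = v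
    · subst huv; right; simpa using h _ _
    · rcases hu with hu | hu
      · left; simpa [huv] using hu
      · right; simpa [Function.update_of_ne huv] using hu

theorem estMarginal_close {f : Finset (Fin n) → ℝ} {ξ : ℝ}
    (h : ∀ j A, |ans j A - f A| ≤ ξ) {M : Finset (Fin n)} (S : Finset (Fin n)) (j : ℕ)
    {u : Fin n} (hu : u ∈ M) :
    |estMarginal ans M S j u - (f (insert u S) - f S)| ≤ 2 * ξ := by
  have h1 := recordAnswers_close ans h S (M.sort (· ≤ ·)) 0 (j + 1) u
    (Or.inl ((Finset.mem_sort _).2 hu))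
  have h2 := h j S
  unfold estMarginal
  rw [abs_le] at *
  constructor <;> linarith [h1.1, h1.2, h2.1, h2.2]

/-- The number of queries depends on the sample sizes only, not on the answers; this makes the
exploration time deterministic almost surely. -/
theorem length_transcript_rsLoop (s : ℝ) {q : ℕ} (l : List (Finset (Fin n) × ℝ))
    (hl : ∀ x ∈ l, x.1.card = q) (S : Finset (Fin n)) (j : ℕ) :
    ((rsLoop s l S).transcript ans j).1.length = l.length * (1 + q) := by
  induction l generalizing S j with
  | nil => simp [rsLoop, QueryProgram.transcript]
  | cons x l ih =>
    obtain ⟨M, U⟩ := x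
    rw [transcript_rsLoop_cons]
    have hM : M.card = q := hl (M, U) (by simp)
    simp only [List.length_cons, List.length_append, List.length_map, Finset.length_sort]
    rw [ih (fun x hx => hl x (by simp [hx])), hM]
    ring

theorem card_transcript_rsLoop (s : ℝ) (l : List (Finset (Fin n) × ℝ))
    (S : Finset (Fin n)) (j : ℕ) :
    (∀ A ∈ ((rsLoop s l S).transcript ans j).1, A.card ≤ S.card + l.length) ∧
      ((rsLoop s l S).transcript ans j).2.card ≤ S.card + l.length := by
  induction l generalizing S j with
  | nil => simp [rsLoop, QueryProgram.transcript]
  | cons x l ih =>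
    obtain ⟨M, U⟩ := x
    rw [transcript_rsLoop_cons]
    have h := ih (rsUpdate M (s * U) (estMarginal ans M S j) S) (j + 1 + M.card)
    have hc := card_rsUpdate_le M (estMarginal ans M S j) (s * U) S
    refine ⟨?_, ?_⟩
    · intro A hA
      simp only [List.mem_cons, List.mem_append, List.mem_map] at hA
      rw [List.length_cons]
      rcases hA with rfl | ⟨u, -, rfl⟩ | hA
      · omega
      · have := Finset.card_insert_le u S
        omega
      · have := h.1 A hA
        omega
    · rw [List.length_cons]
      have := h.2
      simp only
      omega

/-- The first queries, and the output if there are no more, only depend on the first answers. -/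
theorem getD_transcript_congr {ans ans' : ℕ → Finset (Fin n) → ℝ} (p : QueryProgram n) (j i : ℕ)
    (h : ∀ i' < i, ∀ A, (p.transcript ans j).1[i']? = some A →
      ans (j + i') A = ans' (j + i') A) :
    (p.transcript ans j).1[i]? = (p.transcript ans' j).1[i]? ∧
      (p.transcript ans j).1.getD i (p.transcript ans j).2 =
        (p.transcript ans' j).1.getD i (p.transcript ans' j).2 := by
  induction p generalizing j i with
  | done Θ => simp [QueryProgram.transcript]
  | query A next ih =>
    cases i with
    | zero => simp [QueryProgram.transcript]
    | succ i =>
      have h0 : ans j A = ans' j A := by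
        have := h 0 (by omega) A
        simpa [QueryProgram.transcript] using this
      have h1 := ih (ans j A) (j + 1) i (by
        intro i' hi' B hB
        have := h (i' + 1) (by omega) B
        rw [show j + (i' + 1) = j + 1 + i' by ring] at this
        apply this
        simpa [QueryProgram.transcript] using hB)
      simp only [QueryProgram.transcript]
      rw [← h0]
      simpa using h1

end Transcript

/-! ### Measurability -/

section Measurability

variable {n : ℕ}

theorem measurable_rankIn (M : Finset (Fin n)) (u : Fin n) :
    Measurable fun g : Fin n → ℝ => rankIn M g u := by
  classical
  unfold rankIn
  simp only [Finset.card_filter]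
  refine Measurable.add_const (Finset.measurable_sum _ fun v _ => ?_) 1
  refine Measurable.ite ?_ measurable_const measurable_const
  have h1 : MeasurableSet {g : Fin n → ℝ | g u < g v} :=
    measurableSet_lt (measurable_pi_apply u) (measurable_pi_apply v)
  have h2 : MeasurableSet {g : Fin n → ℝ | g v = g u} :=
    measurableSet_eq_fun (measurable_pi_apply v) (measurable_pi_apply u)
  exact h1.union (h2.inter (MeasurableSet.const _))

theorem mem_rsUpdate {M S : Finset (Fin n)} {d : ℝ} {g : Fin n → ℝ} {a : Fin n} :
    a ∈ rsUpdate M d g S ↔ a ∈ S ∨ (a ∈ M ∧ rankIn M g a = ⌈d⌉₊ ∧ 0 ≤ g a) := by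
  simp [rsUpdate]

theorem measurable_rsUpdate (M S : Finset (Fin n)) :
    Measurable fun x : ℝ × (Fin n → ℝ) => rsUpdate M x.1 x.2 S := by
  refine measurable_finset_iff.2 fun a => ?_
  simp only [mem_rsUpdate]
  refine Measurable.or measurable_const (Measurable.and measurable_const (Measurable.and ?_ ?_))
  · refine measurableSet_setOfPred.1 (measurableSet_eq_fun
      ((measurable_rankIn M a).comp measurable_snd)
      (Nat.measurable_ceil.comp measurable_fst))
  · refine measurableSet_setOfPred.1 (measurableSet_le measurable_const ?_)
    exact (measurable_pi_apply a).comp measurable_snd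

theorem measurable_answer (j : ℕ) (A : Finset (Fin n)) :
    Measurable fun ans : ℕ → Finset (Fin n) → ℝ => ans j A :=
  (measurable_pi_apply A).comp (measurable_pi_apply j)

theorem measurable_recordAnswers (S : Finset (Fin n)) (l : List (Fin n)) (j : ℕ) :
    Measurable fun x : (ℕ → Finset (Fin n) → ℝ) × (Fin n → ℝ) =>
      recordAnswers x.1 S l x.2 j := by
  induction l generalizing j with
  | nil => exact measurable_snd
  | cons u l ih =>
    have h : Measurable fun x : (ℕ → Finset (Fin n) → ℝ) × (Fin n → ℝ) =>
        (x.1, Function.update x.2 u (x.1 j (insert u S))) := by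
      refine measurable_fst.prodMk (measurable_pi_iff.2 fun v => ?_)
      by_cases hv : v = u
      · subst hv
        simp only [Function.update_self]
        exact (measurable_answer j _).comp measurable_fst
      · simp only [Function.update_of_ne hv]
        exact (measurable_pi_apply v).comp measurable_snd
    exact (ih (j + 1)).comp h

theorem measurable_estMarginal (M S : Finset (Fin n)) (j : ℕ) :
    Measurable fun ans : ℕ → Finset (Fin n) → ℝ => estMarginal ans M S j := by
  refine measurable_pi_iff.2 fun u => ?_
  unfold estMarginal
  refine Measurable.sub ?_ (measurable_answer j S)
  exact (measurable_pi_apply u).comp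
    ((measurable_recordAnswers S _ _).comp (measurable_id.prodMk measurable_const))

theorem measurable_step_of_sample (s : ℝ) (M S : Finset (Fin n)) (j : ℕ) :
    Measurable fun x : (ℕ → Finset (Fin n) → ℝ) × ℝ =>
      rsUpdate M (s * x.2) (estMarginal x.1 M S j) S := by
  have h1 : Measurable fun x : (ℕ → Finset (Fin n) → ℝ) × ℝ => s * x.2 :=
    measurable_snd.const_mul s
  have h2 : Measurable fun x : (ℕ → Finset (Fin n) → ℝ) × ℝ => estMarginal x.1 M S j :=
    (measurable_estMarginal M S j).comp measurable_fst
  have h3 := h1.prodMk h2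
  have h4 := (measurable_rsUpdate M S).comp h3
  exact h4

theorem measurable_step (s : ℝ) (S : Finset (Fin n)) (j : ℕ) :
    Measurable fun x : Finset (Fin n) × ((ℕ → Finset (Fin n) → ℝ) × ℝ) =>
      rsUpdate x.1 (s * x.2.2) (estMarginal x.2.1 x.1 S j) S := by
  have h := fun M => measurable_step_of_sample s M S j
  exact measurable_from_prod_countable_right h

/-- The first sample and the updated solution take finitely many values, so both may be frozen and
the induction hypothesis applied to the remaining iterations. The functional `φ` is arbitrary so
that it can absorb the queries already made. -/
theorem measurable_transcript_rsLoop {β : Type} [MeasurableSpace β] (s : ℝ) (l : ℕ)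
    (φ : List (Finset (Fin n)) × Finset (Fin n) → β) (S : Finset (Fin n)) (j : ℕ) :
    Measurable fun x : (ℕ → Finset (Fin n) → ℝ) × (Fin l → Finset (Fin n) × ℝ) =>
      φ ((rsLoop s (List.ofFn x.2) S).transcript x.1 j) := by
  induction l generalizing φ S j with
  | zero => simp [rsLoop, QueryProgram.transcript]
  | succ l ih =>
    have e : ∀ x : (ℕ → Finset (Fin n) → ℝ) × (Fin (l + 1) → Finset (Fin n) × ℝ),
        List.ofFn x.2 = ((x.2 0).1, (x.2 0).2) :: List.ofFn fun i => x.2 i.succ := by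
      intro x; rw [List.ofFn_succ]
    simp only [e, transcript_rsLoop_cons]
    let K : (Finset (Fin n) × Finset (Fin n)) ×
        ((ℕ → Finset (Fin n) → ℝ) × (Fin l → Finset (Fin n) × ℝ)) → β := fun y =>
      φ (S :: ((y.1.1.sort (· ≤ ·)).map (fun u => insert u S) ++
        ((rsLoop s (List.ofFn y.2.2) y.1.2).transcript y.2.1 (j + 1 + y.1.1.card)).1),
        ((rsLoop s (List.ofFn y.2.2) y.1.2).transcript y.2.1 (j + 1 + y.1.1.card)).2)
    have hK : Measurable K := by
      refine measurable_from_prod_countable_right fun MS => ?_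
      exact ih (fun tr => φ (S :: ((MS.1.sort (· ≤ ·)).map (fun u => insert u S) ++ tr.1), tr.2))
        MS.2 (j + 1 + MS.1.card)
    have hseed : Measurable fun x : (ℕ → Finset (Fin n) → ℝ) ×
        (Fin (l + 1) → Finset (Fin n) × ℝ) => x.2 0 := by fun_prop
    have hM := measurable_fst.comp hseed
    have hU := measurable_snd.comp hseed
    have hrest : Measurable fun x : (ℕ → Finset (Fin n) → ℝ) ×
        (Fin (l + 1) → Finset (Fin n) × ℝ) => fun i : Fin l => x.2 i.succ := by fun_prop
    have hMU : Measurable fun x : (ℕ → Finset (Fin n) → ℝ) ×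
        (Fin (l + 1) → Finset (Fin n) × ℝ) => ((x.2 0).1, (x.1, (x.2 0).2)) :=
      hM.prodMk (measurable_fst.prodMk hU)
    have hS := (measurable_step s S j).comp hMU
    have hall := (hM.prodMk hS).prodMk (measurable_fst.prodMk hrest)
    exact hK.comp hall

end Measurability

/-! ### One iteration of RandomSampling with estimates of bounded error -/

section Step

variable {n k q : ℕ} {f : Finset (Fin n) → ℝ} {s : ℝ}

theorem sum_subset_eq_sum_mem01 (M : Finset (Fin n)) (φ : Fin n → ℝ) :
    ∑ u ∈ M, φ u = ∑ u, mem01 M u * φ u := by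
  simp [mem01, ite_mul, Finset.sum_ite_mem]

/-- An element is sampled with probability `q/n` and then selected with probability at most `1/s`;
the product is `1/k`, whatever marginals `g` are reported. The conclusion follows from
`IsSubmodular.sum_mul_marginal_ge` at `O ∪ S`. -/
theorem avg_union_ge (hf : IsSubmodular f) (h0 : ∀ A, 0 ≤ f A) (hk : 1 ≤ k) (hq : q ≤ n)
    (hs : s = k * q / n) (hs0 : 0 < s) (g : Finset (Fin n) → Fin n → ℝ)
    (O S : Finset (Fin n)) :
    (1 - 1 / (k : ℝ)) * f (O ∪ S) ≤
      subsetAvg q (fun M => ∫ U, f (O ∪ rsUpdate M (s * U) (g M) S) ∂uniformUnit) := by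
  have hk0 : (0 : ℝ) < k := by exact_mod_cast hk
  have e1 : ∀ M : Finset (Fin n), ∫ U, f (O ∪ rsUpdate M (s * U) (g M) S) ∂uniformUnit =
      f (O ∪ S) + ∑ u, (f (insert u (O ∪ S)) - f (O ∪ S)) *
        (mem01 M u * (selProb M (g M) s u * (if 0 ≤ g M u then 1 else 0))) := by
    intro M
    rw [integral_rsUpdate M (g M) s S (fun A => f (O ∪ A)), sum_subset_eq_sum_mem01]
    congr 1
    refine Finset.sum_congr rfl fun u _ => ?_
    simp only [Finset.union_insert]
    split_ifs <;> ring
  simp_rw [e1]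
  rw [subsetAvg_add, subsetAvg_const hq, subsetAvg_sum]
  simp_rw [subsetAvg_const_mul]
  have key := hf.sum_mul_marginal_ge h0 (O ∪ S)
    (fun u => subsetAvg q (fun M => mem01 M u * (selProb M (g M) s u *
      (if 0 ≤ g M u then 1 else 0)))) (c := 1 / (k : ℝ)) ?_ ?_ (by positivity)
  · simp_rw [mul_comm _ (subsetAvg _ _)]
    linarith
  · intro u
    refine (subsetAvg_const (n := n) hq 0).symm.le.trans (subsetAvg_mono fun M _ => ?_)
    refine mul_nonneg (mem01_nonneg M u) (mul_nonneg (selProb_nonneg M (g M) s u) ?_)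
    split_ifs <;> norm_num
  · intro u
    have hn : (0 : ℝ) < n := by exact_mod_cast u.pos
    have : subsetAvg q (fun M => 1 / s * mem01 M u) = 1 / k := by
      rw [subsetAvg_const_mul, subsetAvg_mem01 hq]
      have hq0 : (q : ℝ) ≠ 0 := by
        rintro h; rw [hs, h] at hs0; simp at hs0
      rw [hs]; field_simp
    rw [← this]
    refine subsetAvg_mono fun M _ => ?_
    have h1 := selProb_le M (g M) hs0 u
    have h2 := selProb_nonneg M (g M) s u
    have h3 := mem01_nonneg M u
    rw [mul_comm (1 / s)]
    refine mul_le_mul_of_nonneg_left ?_ h3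
    split_ifs <;> linarith

/-- The selection is optimal for the reported marginals. Passing between reported and true marginals
costs `2ξ` for the selected element and `2ξ` for the benchmark weights, whose total divided by `s`
is at most `1`. -/
theorem integral_rsUpdate_ge (hs0 : 0 < s) {M O : Finset (Fin n)} (hM : s ≤ M.card) {ξ : ℝ}
    (hξ : 0 ≤ ξ) {g : Fin n → ℝ} {S : Finset (Fin n)}
    (hg : ∀ u ∈ M, |g u - (f (insert u S) - f S)| ≤ 2 * ξ) :
    f S + 1 / s * ∑ u ∈ M, capWeight O s M u * max (f (insert u S) - f S) 0 - 4 * ξ ≤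
      ∫ U, f (rsUpdate M (s * U) g S) ∂uniformUnit := by
  rw [integral_rsUpdate M g s S f]
  have h1 : ∑ u ∈ M, selProb M g s u * max (g u) 0 - 2 * ξ ≤
      ∑ u ∈ M, selProb M g s u * (if 0 ≤ g u then f (insert u S) - f S else 0) := by
    have : ∑ u ∈ M, selProb M g s u * max (g u) 0 - 2 * ξ =
        ∑ u ∈ M, selProb M g s u * (max (g u) 0 - 2 * ξ) := by
      simp only [mul_sub, Finset.sum_sub_distrib]
      rw [← Finset.sum_mul, sum_selProb M g hs0 hM, one_mul]
    rw [this]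
    refine Finset.sum_le_sum fun u hu => mul_le_mul_of_nonneg_left ?_ (selProb_nonneg M g s u)
    have := abs_le.1 (hg u hu)
    split_ifs with h
    · rw [max_eq_left h]; linarith [this.2]
    · rw [max_eq_right (not_le.1 h).le]; linarith
  have h2 := sum_selProb_mul_ge M g hs0 hM (h := fun u => max (g u) 0)
    (fun u => le_max_right _ _) (fun u v huv => max_le_max_right 0 huv)
    (w := capWeight O s M) (capWeight_nonneg hs0.le M) (capWeight_le_one s M)
    (by rw [sum_capWeight hs0.le]; exact min_le_right _ _)
  have h3 : ∑ u ∈ M, capWeight O s M u * max (f (insert u S) - f S) 0 - 2 * ξ * s ≤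
      ∑ u ∈ M, capWeight O s M u * max (g u) 0 := by
    have h4 : ∑ u ∈ M, capWeight O s M u * (2 * ξ) ≤ 2 * ξ * s := by
      rw [← Finset.sum_mul, sum_capWeight hs0.le]
      nlinarith [min_le_right ((M ∩ O).card : ℝ) s]
    have h5 : ∑ u ∈ M, capWeight O s M u * (max (f (insert u S) - f S) 0 - 2 * ξ) ≤
        ∑ u ∈ M, capWeight O s M u * max (g u) 0 := by
      refine Finset.sum_le_sum fun u hu =>
        mul_le_mul_of_nonneg_left ?_ (capWeight_nonneg hs0.le M u)
      have := abs_le.1 (hg u hu)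
      rw [sub_le_iff_le_add]
      refine max_le ?_ ?_
      · linarith [le_max_left (g u) 0]
      · linarith [le_max_right (g u) 0]
    simp only [mul_sub, Finset.sum_sub_distrib] at h5
    linarith
  have h6 := mul_le_mul_of_nonneg_left h3 (by positivity : 0 ≤ 1 / s)
  have h7 : 1 / s * (2 * ξ * s) = 2 * ξ := by field_simp
  rw [mul_sub, h7] at h6
  linarith

/-- The capped weights give each `u ∈ O` an average coefficient of at least `(1-η)/k`. Two sets
appear because `f` need not be monotone: `O` has exactly `k` elements, as symmetry requires, while
`B` carries the optimal value. The positive parts make the elements of `O \ B` harmless. -/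
theorem avg_gain_ge (hf : IsSubmodular f) (hk : 1 ≤ k) (hkn : k ≤ n) (hq : q ≤ n)
    (hs : s = k * q / n) (hs0 : 0 < s) {O B : Finset (Fin n)} (hO : O.card = k)
    (hB : B ⊆ O)
    {η : ℝ} (hη : η ≤ 1)
    (hmin : (1 - η) * s ≤ subsetAvg q (fun M => min ((M ∩ O).card : ℝ) s)) {ξ : ℝ} (hξ : 0 ≤ ξ)
    (g : Finset (Fin n) → Fin n → ℝ) (S : Finset (Fin n))
    (hg : ∀ M, ∀ u ∈ M, |g M u - (f (insert u S) - f S)| ≤ 2 * ξ) :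
    f S + (1 - η) / k * (f (B ∪ S) - f S) - 4 * ξ ≤
      subsetAvg q (fun M => ∫ U, f (rsUpdate M (s * U) (g M) S) ∂uniformUnit) := by
  have hk0 : (0 : ℝ) < k := by exact_mod_cast hk
  have hn0 : (0 : ℝ) < n := by exact_mod_cast lt_of_lt_of_le hk hkn
  have hsq : s ≤ q := by
    rw [hs, div_le_iff₀ hn0, mul_comm]
    exact mul_le_mul_of_nonneg_left (by exact_mod_cast hkn) q.cast_nonneg
  refine le_trans ?_ (subsetAvg_mono fun M hM =>
    integral_rsUpdate_ge (O := O) hs0 (by rw [hM]; exact hsq) hξ (hg M))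
  rw [subsetAvg_sub, subsetAvg_add, subsetAvg_const hq, subsetAvg_const hq, subsetAvg_const_mul]
  have e : ∀ M : Finset (Fin n),
      ∑ u ∈ M, capWeight O s M u * max (f (insert u S) - f S) 0 =
        ∑ u ∈ O, max (f (insert u S) - f S) 0 * (mem01 M u * capWeight O s M u) := by
    intro M
    rw [sum_subset_eq_sum_mem01, sum_subset_eq_sum_mem01 O]
    refine Finset.sum_congr rfl fun u _ => ?_
    simp only [capWeight, mem01]
    split_ifs <;> ring
  simp_rw [e]
  rw [subsetAvg_sum]
  simp_rw [subsetAvg_const_mul]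
  rw [Finset.sum_congr rfl fun u hu => by rw [subsetAvg_capWeight hs0.le hO hu],
    ← Finset.sum_mul]
  set m := subsetAvg q (fun M => min ((M ∩ O).card : ℝ) s)
  set t := ∑ u ∈ O, max (f (insert u S) - f S) 0
  have ht0 : 0 ≤ t := Finset.sum_nonneg fun u _ => le_max_right _ _
  have ht : f (B ∪ S) - f S ≤ t := by
    rw [Finset.union_comm]
    exact ((hf.union_sub_le_sum S B).trans (Finset.sum_le_sum fun u _ => le_max_left _ _)).trans
      (Finset.sum_le_sum_of_subset_of_nonneg hB fun u _ _ => le_max_right _ _)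
  have h1 : (1 - η) / k * t ≤ 1 / s * (t * (m / k)) := by
    have : 1 / s * (t * (m / k)) = m / s / k * t := by field_simp
    rw [this]
    refine mul_le_mul_of_nonneg_right ?_ ht0
    gcongr
    rwa [le_div_iff₀ hs0]
  have h2 : (1 - η) / k * (f (B ∪ S) - f S) ≤ (1 - η) / k * t :=
    mul_le_mul_of_nonneg_left ht (div_nonneg (by linarith) hk0.le)
  linarith

end Step

/-! ### The offline guarantee of RandomSampling -/

section Offline

variable {n k q : ℕ} {f : Finset (Fin n) → ℝ} {s : ℝ}

theorem integrable_comp_finset {Ω : Type*} [MeasurableSpace Ω] (μ : Measure Ω)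
    [IsFiniteMeasure μ] {W : Ω → Finset (Fin n)} (hW : Measurable W) (φ : Finset (Fin n) → ℝ) :
    Integrable (fun x => φ (W x)) μ := by
  refine Integrable.of_bound (((measurable_of_finite φ).comp hW).aestronglyMeasurable)
    (∑ A, |φ A|) (Filter.Eventually.of_forall fun x => ?_)
  rw [Real.norm_eq_abs]
  exact Finset.single_le_sum (f := fun A => |φ A|) (fun A _ => abs_nonneg _)
    (Finset.mem_univ (W x))

/-- The law of the sample and the uniform variable of one iteration of RandomSampling. -/
def stepLaw (n q : ℕ) : Measure (Finset (Fin n) × ℝ) :=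
  (uniformSubset n q).toMeasure.prod uniformUnit

instance : IsProbabilityMeasure (stepLaw n q) := by unfold stepLaw; infer_instance

theorem measurable_step_fixed (ans : ℕ → Finset (Fin n) → ℝ) (s : ℝ) (S : Finset (Fin n))
    (j : ℕ) : Measurable fun x : Finset (Fin n) × ℝ =>
      rsUpdate x.1 (s * x.2) (estMarginal ans x.1 S j) S := by
  have h : Measurable fun x : Finset (Fin n) × ℝ => (x.1, (ans, x.2)) := by fun_prop
  have h' := (measurable_step s S j).comp h
  exact h'

theorem measurable_transcript_fixed {β : Type} [MeasurableSpace β]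
    (ans : ℕ → Finset (Fin n) → ℝ) (s : ℝ) (l : ℕ)
    (φ : List (Finset (Fin n)) × Finset (Fin n) → β) (S : Finset (Fin n)) (j : ℕ) :
    Measurable fun x : Fin l → Finset (Fin n) × ℝ =>
      φ ((rsLoop s (List.ofFn x) S).transcript ans j) := by
  have h : Measurable fun x : Fin l → Finset (Fin n) × ℝ => (ans, x) := by fun_prop
  have h' := (measurable_transcript_rsLoop s l φ S j).comp h
  exact h'

theorem integral_stepLaw (hq : q ≤ n) {φ : Finset (Fin n) × ℝ → ℝ}
    (hφ : Integrable φ (stepLaw n q)) :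
    ∫ x, φ x ∂(stepLaw n q) = subsetAvg q (fun M => ∫ U, φ (M, U) ∂uniformUnit) := by
  unfold stepLaw at *
  rw [integral_prod _ hφ, integral_uniformSubset hq]

theorem integral_value_succ (ans : ℕ → Finset (Fin n) → ℝ) (l : ℕ) (S : Finset (Fin n)) (j : ℕ) :
    ∫ x, f ((rsLoop s (List.ofFn x) S).transcript ans j).2
        ∂(Measure.pi fun _ : Fin (l + 1) => stepLaw n q) =
      ∫ y, (∫ x, f ((rsLoop s (List.ofFn x)
          (rsUpdate y.1 (s * y.2) (estMarginal ans y.1 S j) S)).transcript ans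
            (j + 1 + y.1.card)).2 ∂(Measure.pi fun _ : Fin l => stepLaw n q)) ∂(stepLaw n q) := by
  have hmp := measurePreserving_piFinSuccAbove (fun _ : Fin (l + 1) => stepLaw n q) 0
  have hmeas := measurable_transcript_fixed ans s (l + 1) Prod.snd S j
  have hint := integrable_comp_finset (Measure.pi fun _ : Fin (l + 1) => stepLaw n q) hmeas f
  rw [← hmp.symm.integral_comp', integral_prod]
  · refine integral_congr_ae (Filter.Eventually.of_forall fun y => ?_)
    refine integral_congr_ae (Filter.Eventually.of_forall fun x => ?_)
    have e : (MeasurableEquiv.piFinSuccAbove (fun _ : Fin (l + 1) => Finset (Fin n) × ℝ) 0).symm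
        (y, x) = Fin.cons y x := by
      simp only [MeasurableEquiv.piFinSuccAbove_symm_apply, Fin.insertNthEquiv_zero]
      rfl
    simp only [e]
    rw [List.ofFn_cons]
    obtain ⟨M, U⟩ := y
    rw [transcript_rsLoop_cons]
  · exact hmp.symm.integrable_comp_of_integrable hint

/-- The bound solves the pair of one-step recursions for `f S` and `f (B ∪ S)`, both with decay `a =
1 - 1/k`. The induction peels off the first iteration, hence runs over all starting sets `S` and
query indices `j`. -/
theorem integral_value_ge (hf : IsSubmodular f) (h0 : ∀ A, 0 ≤ f A) (hk : 1 ≤ k) (hkn : k ≤ n)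
    (hq : q ≤ n) (hs : s = k * q / n) (hs0 : 0 < s) {O B : Finset (Fin n)} (hO : O.card = k)
    (hB : B ⊆ O)
    {η : ℝ} (hη0 : 0 ≤ η) (hη : η ≤ 1)
    (hmin : (1 - η) * s ≤ subsetAvg q (fun M => min ((M ∩ O).card : ℝ) s)) {ξ : ℝ}
    {ans : ℕ → Finset (Fin n) → ℝ} (hans : ∀ j A, |ans j A - f A| ≤ ξ) (l : ℕ)
    (S : Finset (Fin n)) (j : ℕ) :
    (1 - 1 / (k : ℝ)) ^ l * f S +
        (1 - η) / k * l * (1 - 1 / (k : ℝ)) ^ (l - 1) * f (B ∪ S) - 4 * l * ξ ≤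
      ∫ x, f ((rsLoop s (List.ofFn x) S).transcript ans j).2
        ∂(Measure.pi fun _ : Fin l => stepLaw n q) := by
  have hξ : 0 ≤ ξ := (abs_nonneg _).trans (hans 0 ∅)
  have hk0 : (0 : ℝ) < k := by exact_mod_cast hk
  have hk1 : (1 : ℝ) ≤ k := by exact_mod_cast hk
  set a : ℝ := 1 - 1 / (k : ℝ) with ha
  have ha0 : 0 ≤ a := by
    rw [ha, sub_nonneg, div_le_one hk0]; exact hk1
  have ha1 : a ≤ 1 := by rw [ha]; linarith [(by positivity : 0 ≤ 1 / (k : ℝ))]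
  set c : ℝ := (1 - η) / k with hc
  have hc0 : 0 ≤ c := div_nonneg (by linarith) hk0.le
  have hca : a ≤ 1 - c := by
    rw [ha, hc]
    have : (1 - η) / k ≤ 1 / (k : ℝ) := by gcongr; linarith
    linarith
  induction l generalizing S j with
  | zero => simp [rsLoop, QueryProgram.transcript]
  | succ l ih =>
    rw [integral_value_succ]
    set W := fun x : Finset (Fin n) × ℝ => rsUpdate x.1 (s * x.2) (estMarginal ans x.1 S j) S
    have hW : Measurable W := measurable_step_fixed ans s S j
    -- The inductive lower bound as a function of the solution after the first iteration; its
    -- expectation is linear in those of `f` and `f (B ∪ ·)`.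
    let LB : Finset (Fin n) → ℝ := fun A =>
      a ^ l * f A + c * l * a ^ (l - 1) * f (B ∪ A) - 4 * l * ξ
    have hLBint : Integrable (fun x => LB (W x)) (stepLaw n q) := integrable_comp_finset _ hW LB
    have hVint : Integrable (fun y : Finset (Fin n) × ℝ => ∫ x, f ((rsLoop s (List.ofFn x)
        (W y)).transcript ans (j + 1 + y.1.card)).2 ∂(Measure.pi fun _ : Fin l => stepLaw n q))
        (stepLaw n q) := by
      have hmeas : Measurable fun y : Finset (Fin n) × ℝ => (y.1, W y) :=
        measurable_fst.prodMk hW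
      refine Integrable.of_bound (((measurable_of_finite (fun z : Finset (Fin n) × Finset (Fin n) =>
        ∫ x, f ((rsLoop s (List.ofFn x) z.2).transcript ans (j + 1 + z.1.card)).2
          ∂(Measure.pi fun _ : Fin l => stepLaw n q))).comp hmeas).aestronglyMeasurable)
        (∑ A, |f A|) (Filter.Eventually.of_forall fun y => ?_)
      refine (norm_integral_le_of_norm_le_const (C := ∑ A, |f A|)
        (Filter.Eventually.of_forall fun x => ?_)).trans (by simp)
      rw [Real.norm_eq_abs]
      exact Finset.single_le_sum (f := fun A => |f A|) (fun A _ => abs_nonneg _)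
        (Finset.mem_univ _)
    refine le_trans ?_ (integral_mono hLBint hVint fun y => ih (W y) (j + 1 + y.1.card))
    rw [integral_stepLaw hq hLBint]
    have e : ∀ M, ∫ U, LB (W (M, U)) ∂uniformUnit =
        a ^ l * (∫ U, f (rsUpdate M (s * U) (estMarginal ans M S j) S) ∂uniformUnit) +
        c * l * a ^ (l - 1) *
          (∫ U, f (B ∪ rsUpdate M (s * U) (estMarginal ans M S j) S) ∂uniformUnit) -
            4 * l * ξ := by
      intro M
      have hWM : Measurable fun U : ℝ => W (M, U) := hW.comp measurable_prodMk_left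
      have i1 := integrable_comp_finset uniformUnit hWM f
      have i2 := integrable_comp_finset uniformUnit hWM (fun A => f (B ∪ A))
      have h1 : ∫ U, LB (W (M, U)) ∂uniformUnit =
          (∫ U, (a ^ l * f (W (M, U)) + c * l * a ^ (l - 1) * f (B ∪ W (M, U))) ∂uniformUnit) -
            ∫ _, 4 * l * ξ ∂uniformUnit :=
        integral_sub ((i1.const_mul _).add (i2.const_mul _)) (integrable_const _)
      rw [h1, integral_add (i1.const_mul _) (i2.const_mul _), integral_const_mul,
        integral_const_mul]
      simp [W]
    simp_rw [e]
    rw [subsetAvg_sub, subsetAvg_add, subsetAvg_const_mul, subsetAvg_const_mul,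
      subsetAvg_const hq]
    have g1 := avg_gain_ge hf hk hkn hq hs hs0 hO hB hη hmin hξ (fun M => estMarginal ans M S j) S
      fun M u hu => estMarginal_close ans hans S j hu
    have g2 := avg_union_ge hf h0 hk hq hs hs0 (fun M => estMarginal ans M S j) B S
    rw [← hc] at g1
    rw [← ha] at g2
    have hal : a ^ l ≤ 1 := pow_le_one₀ ha0 ha1
    have hal0 : 0 ≤ a ^ l := pow_nonneg ha0 l
    -- The coefficient `1 - c` of `f S` may be lowered to `a`, since `c ≤ 1/k` and `f S ≥ 0`.
    have g1' : a * f S + c * f (B ∪ S) - 4 * ξ ≤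
        subsetAvg q (fun M => ∫ U, f (rsUpdate M (s * U) (estMarginal ans M S j) S)
          ∂uniformUnit) := by
      nlinarith [h0 S]
    have g1'' := mul_le_mul_of_nonneg_left g1' hal0
    have g2' := mul_le_mul_of_nonneg_left g2
      (by positivity : 0 ≤ c * l * a ^ (l - 1))
    -- For `l = 0` the exponent `l - 1` truncates to `0`, but the factor `l` vanishes.
    have e2 : c * l * a ^ (l - 1) * (a * f (B ∪ S)) = c * l * a ^ l * f (B ∪ S) := by
      rcases Nat.eq_zero_or_pos l with h | h
      · simp [h]
      · obtain ⟨l', rfl⟩ : ∃ l', l = l' + 1 := ⟨l - 1, by omega⟩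
        simp only [Nat.add_sub_cancel]; ring
    rw [e2] at g2'
    have e3 : a ^ l * (a * f S + c * f (B ∪ S) - 4 * ξ) =
        a ^ (l + 1) * f S + c * a ^ l * f (B ∪ S) - a ^ l * (4 * ξ) := by ring
    rw [e3] at g1''
    have h4 : a ^ l * (4 * ξ) ≤ 4 * ξ := by nlinarith
    simp only [Nat.add_sub_cancel]
    push_cast
    nlinarith

/-- For `k = l + 1` with `l > 0` the base is the inverse of `1 + 1/l`, and `(1 + 1/l)^l ≤ e`; for `k
= 1` the power is `1`. -/
theorem exp_neg_one_le_pow (hk : 1 ≤ k) : (Real.exp 1)⁻¹ ≤ (1 - 1 / (k : ℝ)) ^ (k - 1) := by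
  obtain ⟨l, rfl⟩ : ∃ l, k = l + 1 := ⟨k - 1, by omega⟩
  simp only [Nat.add_sub_cancel]
  push_cast
  rcases Nat.eq_zero_or_pos l with h | h
  · subst h
    simp only [pow_zero]
    exact inv_le_one_of_one_le₀ (Real.one_le_exp zero_le_one)
  · have hl : (0 : ℝ) < l := by exact_mod_cast h
    have e : (1 : ℝ) - 1 / (l + 1) = (1 + 1 / (l : ℝ))⁻¹ := by field_simp; ring
    rw [e, inv_pow]
    refine inv_anti₀ (by positivity) ?_
    calc (1 + 1 / (l : ℝ)) ^ l ≤ (Real.exp (1 / l)) ^ l := by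
          gcongr
          linarith [Real.add_one_le_exp (1 / (l : ℝ))]
      _ = Real.exp 1 := by
          rw [← Real.exp_nat_mul]; congr 1; field_simp

/-- The guarantee of RandomSampling when all answers have error at most `ξ`. -/
theorem integral_rsLoop_ge (hf : IsSubmodular f) (h0 : ∀ A, 0 ≤ f A) (hk : 1 ≤ k) (hkn : k ≤ n)
    (hq : q ≤ n) (hs : s = k * q / n) (hs0 : 0 < s) {η : ℝ} (hη0 : 0 ≤ η) (hη : η ≤ 1)
    (hmin : ∀ O : Finset (Fin n), O.card = k →
      (1 - η) * s ≤ subsetAvg q (fun M => min ((M ∩ O).card : ℝ) s)) {ξ : ℝ}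
    {ans : ℕ → Finset (Fin n) → ℝ} (hans : ∀ j A, |ans j A - f A| ≤ ξ)
    {Sopt : Finset (Fin n)} (hopt : IsOptimal f k Sopt) :
    (1 - η) * (Real.exp 1)⁻¹ * f Sopt - 4 * k * ξ ≤
      ∫ x, f ((rsLoop s (List.ofFn x) ∅).transcript ans 0).2
        ∂(Measure.pi fun _ : Fin k => stepLaw n q) := by
  obtain ⟨O, hSO, hO⟩ := Finset.exists_superset_card_eq hopt.1 (by simpa using hkn)
  have h := integral_value_ge hf h0 hk hkn hq hs hs0 hO hSO hη0 hη (hmin O hO) hans k ∅ 0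
  refine le_trans ?_ h
  have hk0 : (0 : ℝ) < k := by exact_mod_cast hk
  have ha0 : 0 ≤ 1 - 1 / (k : ℝ) := by
    rw [sub_nonneg, div_le_one hk0]; exact_mod_cast hk
  have h1 : 0 ≤ (1 - 1 / (k : ℝ)) ^ k * f ∅ := mul_nonneg (pow_nonneg ha0 k) (h0 ∅)
  have h2 : (1 - η) / k * k = 1 - η := by field_simp
  rw [h2, Finset.union_empty]
  have h3 : (1 - η) * (Real.exp 1)⁻¹ * f Sopt ≤
      (1 - η) * (1 - 1 / (k : ℝ)) ^ (k - 1) * f Sopt := by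
    refine mul_le_mul_of_nonneg_right ?_ (h0 Sopt)
    exact mul_le_mul_of_nonneg_left (exp_neg_one_le_pow hk) (by linarith)
  linarith

end Offline

/-! ### Independence of functions of disjoint coordinates -/

section Independence

open ProbabilityTheory

variable {ι E β γ : Type*} [MeasurableSpace E] [MeasurableSpace β] [MeasurableSpace γ]

/-- Filling the missing coordinates with a fixed point `x₀` writes `F` and `G` as measurable
functions of the two disjoint, hence independent, blocks of coordinates. -/
theorem indepFun_of_dependsOn (P : ι → Measure E) [∀ i, IsProbabilityMeasure (P i)]
    {F : (ι → E) → β} {G : (ι → E) → γ} (hF : Measurable F) (hG : Measurable G)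
    {I J : Finset ι} (hIJ : Disjoint I J) (hFI : DependsOn F (I : Set ι))
    (hGJ : DependsOn G (J : Set ι)) : IndepFun F G (Measure.infinitePi P) := by
  classical
  have hne : Nonempty (ι → E) := (Measure.infinitePi P).nonempty_of_neZero
  obtain ⟨x₀⟩ := hne
  have hX : iIndepFun (fun i (ω : ι → E) => ω i) (Measure.infinitePi P) :=
    iIndepFun_infinitePi (P := P) (X := fun _ => id) fun _ => measurable_id
  have h := hX.indepFun_finset I J hIJ fun i => measurable_pi_apply i
  let ext : (K : Finset ι) → (K → E) → (ι → E) :=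
    fun K y i => if h : i ∈ K then y ⟨i, h⟩ else x₀ i
  have hext : ∀ K, Measurable (ext K) := by
    intro K
    refine measurable_pi_iff.2 fun i => ?_
    by_cases hi : i ∈ K
    · simp only [ext, hi, dif_pos]; exact measurable_pi_apply _
    · simp only [ext, hi, dif_neg, not_false_iff]; exact measurable_const
  have h2 := h.comp (hF.comp (hext I)) (hG.comp (hext J))
  have e1 : (F ∘ ext I) ∘ (fun (a : ι → E) (i : I) => a i) = F := by
    funext x
    refine hFI fun i hi => ?_
    have hi' : i ∈ I := hi
    simp [ext, hi']
  have e2 : (G ∘ ext J) ∘ (fun (a : ι → E) (i : J) => a i) = G := by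
    funext x
    refine hGJ fun i hi => ?_
    have hi' : i ∈ J := hi
    simp [ext, hi']
  rwa [e1, e2] at h2

/-- A random choice `Z` may be averaged separately from the variables `Y` it selects if both depend
on disjoint sets of coordinates. -/
theorem integral_select (P : ι → Measure E) [∀ i, IsProbabilityMeasure (P i)] {n : ℕ}
    {p : Finset (Fin n) → Prop} {Z : (ι → E) → Finset (Fin n)} (hZ : Measurable Z)
    (hZp : ∀ x, p (Z x)) {Y : Finset (Fin n) → (ι → E) → ℝ} (hY : ∀ A, Measurable (Y A))
    (hYint : ∀ A, p A → Integrable (Y A) (Measure.infinitePi P))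
    {I J : Finset ι} (hIJ : Disjoint I J) (hZI : DependsOn Z (I : Set ι))
    (hYJ : ∀ A, DependsOn (Y A) (J : Set ι)) :
    ∫ x, Y (Z x) x ∂(Measure.infinitePi P) =
      ∫ x, (∫ y, Y (Z x) y ∂(Measure.infinitePi P)) ∂(Measure.infinitePi P) := by
  classical
  -- Decompose over the finitely many values of `Z`, keeping only those with `p`, where `Y A` is
  -- known to be integrable; each product then factors by independence.
  let c : Finset (Fin n) → Finset (Fin n) → ℝ := fun A B => if B = A then 1 else 0
  have hc : ∀ A, Measurable fun x => c A (Z x) := fun A => (measurable_of_finite (c A)).comp hZ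
  have hcint : ∀ A, Integrable (fun x => c A (Z x)) (Measure.infinitePi P) :=
    fun A => integrable_comp_finset _ hZ (c A)
  have hind : ∀ A, IndepFun (fun x => c A (Z x)) (Y A) (Measure.infinitePi P) := fun A =>
    indepFun_of_dependsOn P (hc A) (hY A) hIJ
      (fun x y hxy => congrArg (c A) (hZI hxy)) (hYJ A)
  have e1 : ∀ x, Y (Z x) x = ∑ A ∈ Finset.univ.filter p, c A (Z x) * Y A x := by
    intro x
    rw [Finset.sum_eq_single_of_mem (Z x) (by simp [hZp])]
    · simp [c]
    · intro A _ hA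
      simp [c, hA.symm]
  have e2 : ∀ x, (∫ y, Y (Z x) y ∂(Measure.infinitePi P)) =
      ∑ A ∈ Finset.univ.filter p, c A (Z x) * ∫ y, Y A y ∂(Measure.infinitePi P) := by
    intro x
    rw [Finset.sum_eq_single_of_mem (Z x) (by simp [hZp])]
    · simp [c]
    · intro A _ hA
      simp [c, hA.symm]
  simp_rw [e1]
  rw [integral_congr_ae (Filter.Eventually.of_forall e2)]
  rw [integral_finsetSum, integral_finsetSum]
  · refine Finset.sum_congr rfl fun A hA => ?_
    rw [integral_mul_const]
    exact (hind A).integral_mul_eq_mul_integral (hc A).aestronglyMeasurable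
      (hY A).aestronglyMeasurable
  · intro A _
    exact (hcint A).mul_const _
  · intro A hA
    exact (hind A).integrable_mul (hcint A) (hYint A (by simpa using hA))

end Independence

/-! ### Concentration of the estimates -/

section Concentration

open ProbabilityTheory

variable {n k m' : ℕ} {f : Finset (Fin n) → ℝ} {ν : Measure (Finset (Fin n) → ℝ)}
  [IsProbabilityMeasure ν]

/-- Two-sided Hoeffding bound: a centred variable with values in an interval of length `1` is
sub-Gaussian with variance proxy `1/4`. -/
theorem measureReal_sum_deviation_le {Ω ι : Type*} [MeasurableSpace Ω] {μ : Measure Ω}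
    [IsProbabilityMeasure μ] {X : ι → Ω → ℝ} (hX : ∀ i, Measurable (X i)) (hind : iIndepFun X μ)
    (hI : ∀ i, ∀ᵐ ω ∂μ, X i ω ∈ Set.Icc (0 : ℝ) 1) {c : ℝ} (hc : ∀ i, ∫ ω, X i ω ∂μ = c)
    (I : Finset ι) (hI0 : 0 < I.card) {ξ : ℝ} (hξ : 0 ≤ ξ) :
    μ.real {ω | ξ ≤ |(∑ i ∈ I, X i ω) / I.card - c|} ≤
      2 * Real.exp (-(2 * I.card * ξ ^ 2)) := by
  have hN : (0 : ℝ) < I.card := by exact_mod_cast hI0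
  have hsub : ∀ i, HasSubgaussianMGF (fun ω => X i ω - c) ((‖(1 : ℝ) - 0‖₊ / 2) ^ 2) μ := by
    intro i
    have := hasSubgaussianMGF_of_mem_Icc (hX i).aemeasurable (hI i)
    rwa [hc i] at this
  have hind1 : iIndepFun (fun i ω => X i ω - c) μ :=
    hind.comp (fun _ x => x - c) fun _ => measurable_id.sub_const c
  have hind2 : iIndepFun (fun i ω => -(X i ω - c)) μ :=
    hind.comp (fun _ x => -(x - c)) fun _ => (measurable_id.sub_const c).neg
  have hε : 0 ≤ (I.card : ℝ) * ξ := by positivity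
  have h1 := HasSubgaussianMGF.measure_sum_ge_le_of_iIndepFun hind1 (s := I)
    (fun i _ => hsub i) hε
  have h2 := HasSubgaussianMGF.measure_sum_ge_le_of_iIndepFun hind2 (s := I)
    (fun i _ => (hsub i).neg) hε
  have hexp : -((I.card : ℝ) * ξ) ^ 2 / (2 * ((∑ _i ∈ I, (‖(1 : ℝ) - 0‖₊ / 2) ^ 2 : NNReal) : ℝ))
      = -(2 * I.card * ξ ^ 2) := by
    simp
    field_simp
  rw [hexp] at h1 h2
  have hset : {ω | ξ ≤ |(∑ i ∈ I, X i ω) / I.card - c|} ⊆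
      {ω | (I.card : ℝ) * ξ ≤ ∑ i ∈ I, (X i ω - c)} ∪
        {ω | (I.card : ℝ) * ξ ≤ ∑ i ∈ I, -(X i ω - c)} := by
    intro ω hω
    simp only [Set.mem_ofPred_eq, Set.mem_union] at hω ⊢
    rw [Finset.sum_neg_distrib, Finset.sum_sub_distrib, Finset.sum_const, nsmul_eq_mul]
    have e : (∑ i ∈ I, X i ω) - I.card * c = I.card * ((∑ i ∈ I, X i ω) / I.card - c) := by
      field_simp
    rw [e]
    rcases le_abs.1 hω with h | h
    · left; exact mul_le_mul_of_nonneg_left h hN.le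
    · right; rw [← mul_neg]; exact mul_le_mul_of_nonneg_left h hN.le
  refine (measureReal_mono hset).trans ((measureReal_union_le _ _).trans ?_)
  linarith

/-- The estimates of the server as a function of the rewards and of the selected agents. -/
def estimate (m r : ℕ) (x : Fin m' × ℕ → Finset (Fin n) → ℝ) (σ : ℕ → Finset (Fin m')) (j : ℕ)
    (A : Finset (Fin n)) : ℝ :=
  (∑ i ∈ σ j, (∑ s ∈ Finset.range r, x (i, j * r + s) A) / r) / m

theorem measureReal_estimate_deviation_le (hν : IsRewardLaw k f ν) {m r : ℕ} (hm : 1 ≤ m)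
    (hr : 1 ≤ r) {σ : ℕ → Finset (Fin m')} {j : ℕ} (hσ : (σ j).card = m) {A : Finset (Fin n)}
    (hA : A.card ≤ k) {ξ : ℝ} (hξ : 0 ≤ ξ) :
    (Measure.infinitePi fun _ : Fin m' × ℕ => ν).real {x | ξ ≤ |estimate m r x σ j A - f A|} ≤
      2 * Real.exp (-(2 * (m * r) * ξ ^ 2)) := by
  set P := Measure.infinitePi fun _ : Fin m' × ℕ => ν
  -- For fixed selections the estimate averages `m r` rewards at distinct agent-time pairs, which
  -- are i.i.d.
  have hinj : Function.Injective fun p : Fin m' × ℕ => (p.1, j * r + p.2) := by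
    rintro ⟨a, b⟩ ⟨c, d⟩ h
    simp only [Prod.mk.injEq, Nat.add_left_cancel_iff] at h
    exact Prod.ext h.1 h.2
  let X : Fin m' × ℕ → (Fin m' × ℕ → Finset (Fin n) → ℝ) → ℝ := fun p x => x (p.1, j * r + p.2) A
  have hX : ∀ p, Measurable (X p) := fun p => (measurable_pi_apply A).comp (measurable_pi_apply _)
  have hind0 : iIndepFun (fun p (x : Fin m' × ℕ → Finset (Fin n) → ℝ) => x p A) P :=
    iIndepFun_infinitePi (P := fun _ : Fin m' × ℕ => ν) (X := fun _ y => y A)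
      fun _ => measurable_pi_apply A
  have hind : iIndepFun X P := hind0.precomp hinj
  have hmp : ∀ p, MeasurePreserving (Function.eval p) P ν := fun p =>
    measurePreserving_eval_infinitePi (fun _ : Fin m' × ℕ => ν) p
  have h01 : ∀ p, ∀ᵐ x ∂P, X p x ∈ Set.Icc (0 : ℝ) 1 := fun p =>
    (hmp (p.1, j * r + p.2)).quasiMeasurePreserving.ae (hν A hA).1
  have hmean : ∀ p, ∫ x, X p x ∂P = f A := by
    intro p
    rw [← (hν A hA).2, ← (hmp (p.1, j * r + p.2)).map_eq, integral_map]
    · exact (measurable_pi_apply _).aemeasurable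
    · exact (measurable_pi_apply A).aestronglyMeasurable
  have hcard : (σ j ×ˢ Finset.range r).card = m * r := by simp [hσ]
  have h := measureReal_sum_deviation_le hX hind h01 hmean (σ j ×ˢ Finset.range r)
    (by rw [hcard]; positivity) hξ
  rw [hcard] at h
  push_cast at h
  convert h using 8 with x
  unfold estimate
  rw [← Finset.sum_div, div_div, Finset.sum_product, mul_comm (r : ℝ)]

end Concentration

/-! ### The run of the federated algorithm -/

section FederatedRun

open ProbabilityTheory

variable {n k m' : ℕ}

/-- The queries and the output of RandomSampling with seed `z` when the server's estimates come
from the rewards `x` and the selections `σ`. -/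
def rsRun (s : ℝ) (m r : ℕ) (x : Fin m' × ℕ → Finset (Fin n) → ℝ) (σ : ℕ → Finset (Fin m'))
    (z : Fin k → Finset (Fin n) × ℝ) : List (Finset (Fin n)) × Finset (Fin n) :=
  (rsLoop s (List.ofFn z) ∅).transcript (estimate m r x σ) 0

/-- The action played at time `t`. -/
def played (s : ℝ) (m r : ℕ) (x : Fin m' × ℕ → Finset (Fin n) → ℝ) (σ : ℕ → Finset (Fin m'))
    (z : Fin k → Finset (Fin n) × ℝ) (t : ℕ) : Finset (Fin n) :=
  (rsRun s m r x σ z).1.getD (t / r) (rsRun s m r x σ z).2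

theorem measurable_estimate (m r : ℕ) :
    Measurable fun y : (Fin m' × ℕ → Finset (Fin n) → ℝ) × (ℕ → Finset (Fin m')) =>
      estimate m r y.1 y.2 := by
  classical
  refine measurable_pi_iff.2 fun j => measurable_pi_iff.2 fun A => ?_
  have e : ∀ y : (Fin m' × ℕ → Finset (Fin n) → ℝ) × (ℕ → Finset (Fin m')),
      estimate m r y.1 y.2 j A =
        (∑ i, (if i ∈ y.2 j then (∑ s ∈ Finset.range r, y.1 (i, j * r + s) A) / r else 0)) / m := by
    intro y
    simp [estimate, Finset.sum_ite_mem]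
  simp_rw [e]
  refine Measurable.div_const (Finset.measurable_sum _ fun i _ => ?_) _
  refine Measurable.ite ?_ ?_ measurable_const
  · have h : Measurable fun y : (Fin m' × ℕ → Finset (Fin n) → ℝ) × (ℕ → Finset (Fin m')) =>
        y.2 j := by fun_prop
    exact h (measurableSet_mem_finset i)
  · refine Measurable.div_const (Finset.measurable_sum _ fun s _ => ?_) _
    exact (measurable_pi_apply A).comp ((measurable_pi_apply _).comp measurable_fst)

theorem measurable_rsRun {β : Type} [MeasurableSpace β] (s : ℝ) (m r : ℕ)
    (φ : List (Finset (Fin n)) × Finset (Fin n) → β) :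
    Measurable fun ω : (Fin m' × ℕ → Finset (Fin n) → ℝ) × (ℕ → Finset (Fin m')) ×
      (Fin k → Finset (Fin n) × ℝ) => φ (rsRun s m r ω.1 ω.2.1 ω.2.2) := by
  have h1 : Measurable fun ω : (Fin m' × ℕ → Finset (Fin n) → ℝ) × (ℕ → Finset (Fin m')) ×
      (Fin k → Finset (Fin n) × ℝ) => (ω.1, ω.2.1) := by fun_prop
  have h2 : Measurable fun ω : (Fin m' × ℕ → Finset (Fin n) → ℝ) × (ℕ → Finset (Fin m')) ×
      (Fin k → Finset (Fin n) × ℝ) => ω.2.2 := by fun_prop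
  have h3 := (measurable_estimate m r).comp h1
  have h4 := (measurable_transcript_rsLoop s k φ ∅ 0).comp (h3.prodMk h2)
  exact h4

theorem measurable_played (s : ℝ) (m r t : ℕ) :
    Measurable fun ω : (Fin m' × ℕ → Finset (Fin n) → ℝ) × (ℕ → Finset (Fin m')) ×
      (Fin k → Finset (Fin n) × ℝ) => played s m r ω.1 ω.2.1 ω.2.2 t := by
  have h := measurable_rsRun (m' := m') (k := k) s m r
    fun tr : List (Finset (Fin n)) × Finset (Fin n) => tr.1.getD (t / r) tr.2
  exact h

theorem card_played_le (s : ℝ) (m r : ℕ) (x : Fin m' × ℕ → Finset (Fin n) → ℝ)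
    (σ : ℕ → Finset (Fin m')) (z : Fin k → Finset (Fin n) × ℝ) (t : ℕ) :
    (played s m r x σ z t).card ≤ k := by
  have h := card_transcript_rsLoop (estimate m r x σ) s (List.ofFn z) ∅ 0
  simp only [Finset.card_empty, List.length_ofFn, zero_add] at h
  unfold played
  rw [List.getD_eq_getElem?_getD]
  cases h' : (rsRun s m r x σ z).1[t / r]? with
  | none => exact h.2
  | some A => exact h.1 A (List.mem_of_getElem? h')

theorem dependsOn_estimate (m : ℕ) {r : ℕ} (σ : ℕ → Finset (Fin m')) (j : ℕ)
    (A : Finset (Fin n)) :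
    DependsOn (fun x : Fin m' × ℕ → Finset (Fin n) → ℝ => estimate m r x σ j A)
      ((Finset.univ ×ˢ Finset.Ico (j * r) (j * r + r) : Finset (Fin m' × ℕ)) :
        Set (Fin m' × ℕ)) := by
  intro x y hxy
  simp only [estimate]
  congr 1
  refine Finset.sum_congr (M := ℝ) rfl fun i _ => ?_
  congr 1
  refine Finset.sum_congr (M := ℝ) rfl fun s hs => ?_
  rw [hxy (i, j * r + s) (by simpa using hs)]

/-- The action at time `t` is determined by the answers of the rounds `j < t / r`, all of which end
by time `t`. -/
theorem dependsOn_played (s : ℝ) (m : ℕ) {r : ℕ} (σ : ℕ → Finset (Fin m'))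
    (z : Fin k → Finset (Fin n) × ℝ) (t : ℕ) :
    DependsOn (fun x : Fin m' × ℕ → Finset (Fin n) → ℝ => played s m r x σ z t)
      ((Finset.univ ×ˢ Finset.range t : Finset (Fin m' × ℕ)) : Set (Fin m' × ℕ)) := by
  intro x y hxy
  refine (getD_transcript_congr (rsLoop s (List.ofFn z) ∅) 0 (t / r) fun j hj A _ => ?_).2
  refine dependsOn_estimate m σ _ A fun p hp => hxy p ?_
  simp only [zero_add, Finset.coe_product, Finset.coe_univ, Finset.coe_Ico, Set.mem_prod,
    Set.mem_univ, Set.mem_Ico, true_and, Finset.coe_range, Set.mem_Iio] at hp ⊢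
  have h1 : (j + 1) * r ≤ t / r * r := Nat.mul_le_mul_right r hj
  have h2 := Nat.div_mul_le_self t r
  have h3 : (j + 1) * r = j * r + r := by ring
  omega

variable {f : Finset (Fin n) → ℝ} {ν : Measure (Finset (Fin n) → ℝ)} [IsProbabilityMeasure ν]

/-- The law of the rewards. -/
def rewardLaw (m' : ℕ) (ν : Measure (Finset (Fin n) → ℝ)) :
    Measure (Fin m' × ℕ → Finset (Fin n) → ℝ) :=
  Measure.infinitePi fun _ => ν

instance : IsProbabilityMeasure (rewardLaw m' ν) := by unfold rewardLaw; infer_instance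

theorem measurable_reward (p : Fin m' × ℕ) (A : Finset (Fin n)) :
    Measurable fun x : Fin m' × ℕ → Finset (Fin n) → ℝ => x p A :=
  (measurable_pi_apply A).comp (measurable_pi_apply p)

theorem ae_reward_mem (hν : IsRewardLaw k f ν) (p : Fin m' × ℕ) :
    ∀ᵐ x ∂(rewardLaw m' ν), ∀ A : Finset (Fin n), A.card ≤ k → x p A ∈ Set.Icc (0 : ℝ) 1 := by
  have hmp := measurePreserving_eval_infinitePi (fun _ : Fin m' × ℕ => ν) p
  refine ae_all_iff.2 fun A => ?_
  by_cases hA : A.card ≤ k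
  · filter_upwards [hmp.quasiMeasurePreserving.ae (hν A hA).1] with x hx _ using hx
  · exact Filter.Eventually.of_forall fun x h => absurd h hA

theorem integral_reward (hν : IsRewardLaw k f ν) (p : Fin m' × ℕ) {A : Finset (Fin n)}
    (hA : A.card ≤ k) : ∫ x, x p A ∂(rewardLaw m' ν) = f A := by
  have hmp := measurePreserving_eval_infinitePi (fun _ : Fin m' × ℕ => ν) p
  have h := integral_map (μ := rewardLaw m' ν) (φ := Function.eval p)
    (f := fun y : Finset (Fin n) → ℝ => y A) (measurable_pi_apply p).aemeasurable
    (measurable_pi_apply A).aestronglyMeasurable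
  rw [show (rewardLaw m' ν).map (Function.eval p) = ν from hmp.map_eq] at h
  exact h.symm.trans (hν A hA).2

theorem integrable_reward (hν : IsRewardLaw k f ν) (p : Fin m' × ℕ) {A : Finset (Fin n)}
    (hA : A.card ≤ k) : Integrable (fun x => x p A) (rewardLaw m' ν) := by
  refine Integrable.of_bound (measurable_reward p A).aestronglyMeasurable 1 ?_
  filter_upwards [ae_reward_mem hν p] with x hx
  rw [Real.norm_eq_abs, abs_of_nonneg (hx A hA).1]
  exact (hx A hA).2

theorem mem_Icc_of_isRewardLaw (hν : IsRewardLaw k f ν) {A : Finset (Fin n)} (hA : A.card ≤ k) :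
    f A ∈ Set.Icc (0 : ℝ) 1 := by
  have h := hν A hA
  have hint : Integrable (fun x : Finset (Fin n) → ℝ => x A) ν := by
    refine Integrable.of_bound (measurable_pi_apply A).aestronglyMeasurable 1 ?_
    filter_upwards [h.1] with x hx
    rw [Real.norm_eq_abs, abs_of_nonneg hx.1]
    exact hx.2
  rw [← h.2]
  constructor
  · exact integral_nonneg_of_ae (by filter_upwards [h.1] with x hx using hx.1)
  · have := integral_mono_ae hint (integrable_const (1 : ℝ))
      (by filter_upwards [h.1] with x hx using hx.2)
    simpa using this

theorem measurable_played_fixed (s : ℝ) (m r t : ℕ) (σ : ℕ → Finset (Fin m'))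
    (z : Fin k → Finset (Fin n) × ℝ) :
    Measurable fun x : Fin m' × ℕ → Finset (Fin n) → ℝ => played s m r x σ z t := by
  have h := (measurable_played (m' := m') (k := k) (n := n) s m r t).comp
    (measurable_prodMk_right (y := (σ, z)))
  exact h

/-- The action uses rewards before time `t` only, so it is independent of the rewards at time `t`
and their mean may be taken first. -/
theorem integral_reward_played (hν : IsRewardLaw k f ν) (s : ℝ) (m r t : ℕ) (i : Fin m')
    (σ : ℕ → Finset (Fin m')) (z : Fin k → Finset (Fin n) × ℝ) :
    ∫ x, x (i, t) (played s m r x σ z t) ∂(rewardLaw m' ν) =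
      ∫ x, f (played s m r x σ z t) ∂(rewardLaw m' ν) := by
  have h := integral_select (fun _ : Fin m' × ℕ => ν) (p := fun A => A.card ≤ k)
    (measurable_played_fixed s m r t σ z) (fun x => card_played_le s m r x σ z t)
    (Y := fun A x => x (i, t) A) (measurable_reward (i, t))
    (fun A hA => integrable_reward hν (i, t) hA)
    (I := Finset.univ ×ˢ Finset.range t) (J := {(i, t)}) (by simp)
    (dependsOn_played s m σ z t) (fun A x y hxy => congrFun (hxy (i, t) (by simp)) A)
  refine h.trans (integral_congr_ae (Filter.Eventually.of_forall fun x => ?_))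
  exact integral_reward hν (i, t) (card_played_le s m r x σ z t)

/-- The event that the estimate in round `j` of the set queried there is off by at least `ξ`. -/
def badRound (f : Finset (Fin n) → ℝ) (s : ℝ) (m r : ℕ) (ξ : ℝ) (j : ℕ) :
    Set ((Fin m' × ℕ → Finset (Fin n) → ℝ) × (ℕ → Finset (Fin m')) ×
      (Fin k → Finset (Fin n) × ℝ)) :=
  {ω | ξ ≤ |estimate m r ω.1 ω.2.1 j (played s m r ω.1 ω.2.1 ω.2.2 (j * r)) -
    f (played s m r ω.1 ω.2.1 ω.2.2 (j * r))|}

theorem measurableSet_badRound (f : Finset (Fin n) → ℝ) (s : ℝ) (m r : ℕ) (ξ : ℝ) (j : ℕ) :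
    MeasurableSet (badRound (m' := m') (k := k) f s m r ξ j) := by
  have h1 : Measurable fun ω : (Fin m' × ℕ → Finset (Fin n) → ℝ) × (ℕ → Finset (Fin m')) ×
      (Fin k → Finset (Fin n) × ℝ) => (ω.1, ω.2.1) := by fun_prop
  have h2 := (measurable_estimate m r).comp h1
  have h3 := measurable_played (m' := m') (k := k) (n := n) s m r (j * r)
  have h4 : Measurable fun y : Finset (Fin n) × (ℕ → Finset (Fin n) → ℝ) => |y.2 j y.1 - f y.1| :=
    measurable_from_prod_countable_right fun A =>
      measurable_abs.comp ((measurable_answer j A).sub_const (f A))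
  have h5 := h4.comp (h3.prodMk h2)
  exact measurableSet_le measurable_const h5

theorem measureReal_badRound_section_le (hν : IsRewardLaw k f ν) (s : ℝ) {m r : ℕ} (hm : 1 ≤ m)
    (hr : 1 ≤ r) {ξ : ℝ} (hξ : 0 ≤ ξ) (j : ℕ) {σ : ℕ → Finset (Fin m')} (hσ : (σ j).card = m)
    (z : Fin k → Finset (Fin n) × ℝ) :
    ∫ x, (badRound f s m r ξ j).indicator (fun _ => (1 : ℝ)) (x, σ, z) ∂(rewardLaw m' ν) ≤
      2 * Real.exp (-(2 * (m * r) * ξ ^ 2)) := by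
  let B : Finset (Fin n) → Set (Fin m' × ℕ → Finset (Fin n) → ℝ) :=
    fun A => {x | ξ ≤ |estimate m r x σ j A - f A|}
  have hest : Measurable fun x : Fin m' × ℕ → Finset (Fin n) → ℝ => estimate m r x σ := by
    have h := (measurable_estimate (m' := m') (n := n) m r).comp
      (measurable_prodMk_right (y := σ))
    exact h
  have hB : ∀ A, MeasurableSet (B A) := fun A =>
    measurableSet_le measurable_const
      (measurable_abs.comp (((measurable_answer j A).comp hest).sub_const (f A)))
  have h := integral_select (fun _ : Fin m' × ℕ => ν) (p := fun A => A.card ≤ k)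
    (measurable_played_fixed s m r (j * r) σ z) (fun x => card_played_le s m r x σ z (j * r))
    (Y := fun A => (B A).indicator fun _ => (1 : ℝ))
    (fun A => measurable_const.indicator (hB A))
    (fun A _ => (integrable_const 1).indicator (hB A))
    -- The queried set depends on rewards before round `j`, its estimate on those of round `j`. This
    -- disjointness lets the deviation bound for a fixed set apply to the adaptively chosen one.
    (I := Finset.univ ×ˢ Finset.range (j * r))
    (J := Finset.univ ×ˢ Finset.Ico (j * r) (j * r + r))
    (by
      rw [Finset.disjoint_left]
      intro p hp hp'
      simp only [Finset.mem_product, Finset.mem_univ, true_and, Finset.mem_range,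
        Finset.mem_Ico] at hp hp'
      omega)
    (dependsOn_played s m σ z (j * r))
    (fun A x y hxy => by
      have := dependsOn_estimate (n := n) m σ j A hxy
      simp only at this
      simp only [B, Set.indicator_apply, Set.mem_ofPred_eq, this])
  have h' : ∫ x, (badRound f s m r ξ j).indicator (fun _ => (1 : ℝ)) (x, σ, z)
      ∂(rewardLaw m' ν) = _ := h
  rw [h']
  refine (integral_mono_of_nonneg (Filter.Eventually.of_forall fun x => ?_)
    (integrable_const (2 * Real.exp (-(2 * (m * r) * ξ ^ 2))))
    (Filter.Eventually.of_forall fun x => ?_)).trans (by simp)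
  · exact integral_nonneg fun y => Set.indicator_nonneg (fun _ _ => zero_le_one) _
  · simp only
    rw [integral_indicator_const _ (hB _), smul_eq_mul, mul_one]
    exact measureReal_estimate_deviation_le hν hm hr hσ (card_played_le s m r x σ z (j * r)) hξ

end FederatedRun

/-! ### Expectations under the joint law -/

section JointLaw

open ProbabilityTheory

variable {n k q m m' : ℕ} {f : Finset (Fin n) → ℝ} {ν : Measure (Finset (Fin n) → ℝ)}

/-- The law of the selections of communicating agents and of the seed of RandomSampling. -/
def auxLaw (n k q m m' : ℕ) :
    Measure ((ℕ → Finset (Fin m')) × (Fin k → Finset (Fin n) × ℝ)) :=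
  (Measure.infinitePi fun _ => (uniformSubset m' m).toMeasure).prod
    (Measure.pi fun _ => stepLaw n q)

instance : IsProbabilityMeasure (auxLaw n k q m m') := by unfold auxLaw; infer_instance

/-- The joint law of the rewards, the selections and the seed. -/
def jointLaw (k q m m' : ℕ) (ν : Measure (Finset (Fin n) → ℝ)) :
    Measure ((Fin m' × ℕ → Finset (Fin n) → ℝ) × (ℕ → Finset (Fin m')) ×
      (Fin k → Finset (Fin n) × ℝ)) :=
  (rewardLaw m' ν).prod (auxLaw n k q m m')

theorem ae_card_selection (hm : m ≤ m') :
    ∀ᵐ w ∂(auxLaw n k q m m'), ∀ j, (w.1 j).card = m := by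
  have h : ∀ᵐ σ ∂(Measure.infinitePi fun _ : ℕ => (uniformSubset m' m).toMeasure),
      ∀ j, (σ j).card = m := ae_all_iff.2 fun j =>
    (measurePreserving_eval_infinitePi (fun _ : ℕ => (uniformSubset m' m).toMeasure)
      j).quasiMeasurePreserving.ae (ae_card_uniformSubset hm)
  exact Measure.quasiMeasurePreserving_fst.ae h

theorem ae_card_sample (hq : q ≤ n) :
    ∀ᵐ w ∂(auxLaw n k q m m'), ∀ i, (w.2 i).1.card = q := by
  have h1 : ∀ᵐ x ∂(stepLaw n q), x.1.card = q :=
    Measure.quasiMeasurePreserving_fst.ae (ae_card_uniformSubset hq)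
  have h : ∀ᵐ z ∂(Measure.pi fun _ : Fin k => stepLaw n q), ∀ i, (z i).1.card = q :=
    ae_all_iff.2 fun i =>
      (measurePreserving_eval (fun _ : Fin k => stepLaw n q) i).quasiMeasurePreserving.ae h1
  exact Measure.quasiMeasurePreserving_snd.ae h

theorem length_rsRun (s : ℝ) (r : ℕ) (x : Fin m' × ℕ → Finset (Fin n) → ℝ)
    (σ : ℕ → Finset (Fin m')) {z : Fin k → Finset (Fin n) × ℝ} (hz : ∀ i, (z i).1.card = q) :
    (rsRun s m r x σ z).1.length = k * (1 + q) := by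
  have h := length_transcript_rsLoop (estimate m r x σ) s (q := q) (List.ofFn z) (by
    intro y hy
    obtain ⟨i, rfl⟩ := (List.mem_ofFn' z y).1 hy
    exact hz i) ∅ 0
  rwa [List.length_ofFn] at h

theorem ae_length_rsRun (hq : q ≤ n) (s : ℝ) (r : ℕ) :
    ∀ᵐ ω ∂(jointLaw k q m m' ν), (rsRun s m r ω.1 ω.2.1 ω.2.2).1.length = k * (1 + q) := by
  have h : ∀ᵐ ω ∂(jointLaw k q m m' ν), ∀ i, (ω.2.2 i).1.card = q :=
    Measure.quasiMeasurePreserving_snd.ae (ae_card_sample hq)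
  filter_upwards [h] with ω hω
  exact length_rsRun s r ω.1 ω.2.1 hω

/-! ### Failure probability, clipped answers and the quality of the output. -/

variable [IsProbabilityMeasure ν]

instance : IsProbabilityMeasure (jointLaw k q m m' ν) := by unfold jointLaw; infer_instance

theorem measureReal_badRound_le (hν : IsRewardLaw k f ν) (s : ℝ) {r : ℕ} (hm : 1 ≤ m)
    (hmm : m ≤ m') (hr : 1 ≤ r) {ξ : ℝ} (hξ : 0 ≤ ξ) (j : ℕ) :
    (jointLaw k q m m' ν).real (badRound f s m r ξ j) ≤
      2 * Real.exp (-(2 * (m * r) * ξ ^ 2)) := by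
  have hB := measurableSet_badRound (m' := m') (k := k) f s m r ξ j
  have h1 : (jointLaw k q m m' ν).real (badRound f s m r ξ j) =
      ∫ ω, (badRound f s m r ξ j).indicator (fun _ => (1 : ℝ)) ω ∂(jointLaw k q m m' ν) := by
    rw [integral_indicator_const _ hB, smul_eq_mul, mul_one]
  rw [h1]
  unfold jointLaw
  rw [integral_prod_symm]
  · refine (integral_mono_of_nonneg (Filter.Eventually.of_forall fun w => ?_)
      (integrable_const (2 * Real.exp (-(2 * (m * r) * ξ ^ 2)))) ?_).trans (by simp)
    · exact integral_nonneg fun y => Set.indicator_nonneg (fun _ _ => zero_le_one) _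
    · filter_upwards [ae_card_selection hmm] with w hw
      exact measureReal_badRound_section_le hν s hm hr hξ j (hw j) w.2
  · exact (integrable_const 1).indicator hB

/-- The answers moved to within `ξ` of the values of `f`. -/
def clipAnswers (f : Finset (Fin n) → ℝ) (ξ : ℝ) (ans : ℕ → Finset (Fin n) → ℝ) (j : ℕ)
    (A : Finset (Fin n)) : ℝ :=
  f A + max (-ξ) (min ξ (ans j A - f A))

theorem clipAnswers_close (f : Finset (Fin n) → ℝ) {ξ : ℝ} (hξ : 0 ≤ ξ)
    (ans : ℕ → Finset (Fin n) → ℝ) (j : ℕ) (A : Finset (Fin n)) :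
    |clipAnswers f ξ ans j A - f A| ≤ ξ := by
  unfold clipAnswers
  rw [add_sub_cancel_left, abs_le]
  exact ⟨le_max_left _ _, max_le (by linarith) (min_le_left _ _)⟩

theorem clipAnswers_eq {f : Finset (Fin n) → ℝ} {ξ : ℝ} {ans : ℕ → Finset (Fin n) → ℝ} {j : ℕ}
    {A : Finset (Fin n)} (h : |ans j A - f A| ≤ ξ) : clipAnswers f ξ ans j A = ans j A := by
  rw [abs_le] at h
  unfold clipAnswers
  rw [min_eq_right h.2, max_eq_right h.1]
  ring

theorem measurable_clipAnswers (f : Finset (Fin n) → ℝ) (ξ : ℝ) :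
    Measurable (clipAnswers f ξ) :=
  measurable_pi_iff.2 fun j => measurable_pi_iff.2 fun A =>
    (measurable_const.max (measurable_const.min
      ((measurable_answer j A).sub_const (f A)))).const_add (f A)

/-- The output of RandomSampling when the estimates are clipped. -/
def clippedOutput (f : Finset (Fin n) → ℝ) (ξ s : ℝ) (m r : ℕ)
    (x : Fin m' × ℕ → Finset (Fin n) → ℝ) (σ : ℕ → Finset (Fin m'))
    (z : Fin k → Finset (Fin n) × ℝ) : Finset (Fin n) :=
  ((rsLoop s (List.ofFn z) ∅).transcript (clipAnswers f ξ (estimate m r x σ)) 0).2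

theorem measurable_clippedOutput (f : Finset (Fin n) → ℝ) (ξ s : ℝ) (m r : ℕ) :
    Measurable fun ω : (Fin m' × ℕ → Finset (Fin n) → ℝ) × (ℕ → Finset (Fin m')) ×
      (Fin k → Finset (Fin n) × ℝ) => clippedOutput f ξ s m r ω.1 ω.2.1 ω.2.2 := by
  have h1 : Measurable fun ω : (Fin m' × ℕ → Finset (Fin n) → ℝ) × (ℕ → Finset (Fin m')) ×
      (Fin k → Finset (Fin n) × ℝ) => (ω.1, ω.2.1) := by fun_prop
  have h2 : Measurable fun ω : (Fin m' × ℕ → Finset (Fin n) → ℝ) × (ℕ → Finset (Fin m')) ×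
      (Fin k → Finset (Fin n) × ℝ) => ω.2.2 := by fun_prop
  have h3 := (measurable_clipAnswers f ξ).comp ((measurable_estimate m r).comp h1)
  have h4 := (measurable_transcript_rsLoop s k Prod.snd ∅ 0).comp (h3.prodMk h2)
  exact h4

theorem integral_clippedOutput_ge (hf : IsSubmodular f) (h0 : ∀ A, 0 ≤ f A) (hk : 1 ≤ k)
    (hkn : k ≤ n) (hq : q ≤ n) {s : ℝ} (hs : s = k * q / n) (hs0 : 0 < s) {η : ℝ} (hη0 : 0 ≤ η)
    (hη : η ≤ 1) (hmin : ∀ O : Finset (Fin n), O.card = k →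
      (1 - η) * s ≤ subsetAvg q (fun M => min ((M ∩ O).card : ℝ) s)) {ξ : ℝ} (hξ : 0 ≤ ξ)
    {Sopt : Finset (Fin n)} (hopt : IsOptimal f k Sopt) (r : ℕ) :
    (1 - η) * (Real.exp 1)⁻¹ * f Sopt - 4 * k * ξ ≤
      ∫ ω, f (clippedOutput f ξ s m r ω.1 ω.2.1 ω.2.2) ∂(jointLaw k q m m' ν) := by
  set c := (1 - η) * (Real.exp 1)⁻¹ * f Sopt - 4 * k * ξ
  have hmeas := measurable_clippedOutput (m' := m') (k := k) f ξ s m r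
  have hint := integrable_comp_finset (jointLaw k q m m' ν) hmeas f
  have hx : ∀ x : Fin m' × ℕ → Finset (Fin n) → ℝ,
      c ≤ ∫ w, f (clippedOutput f ξ s m r x w.1 w.2) ∂(auxLaw n k q m m') := by
    intro x
    have hmx : Measurable fun w : (ℕ → Finset (Fin m')) × (Fin k → Finset (Fin n) × ℝ) =>
        clippedOutput f ξ s m r x w.1 w.2 := by
      have h := hmeas.comp (measurable_prodMk_left (x := x))
      exact h
    have hintx := integrable_comp_finset (auxLaw n k q m m') hmx f
    unfold auxLaw at hintx ⊢
    rw [integral_prod _ hintx]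
    have h1 := integral_mono (integrable_const c) hintx.integral_prod_left fun σ =>
      integral_rsLoop_ge hf h0 hk hkn hq hs hs0 hη0 hη hmin
        (clipAnswers_close f hξ (estimate m r x σ)) hopt
    simpa using h1
  unfold jointLaw at hint ⊢
  rw [integral_prod _ hint]
  have h1 := integral_mono (integrable_const c) hint.integral_prod_left hx
  simpa using h1

/-- The real run is coupled with the run on clipped answers. If no round among the first `N` is bad,
the two outputs coincide; otherwise at most `1` is lost, because `f` takes values in `[0,1]` on
feasible sets. -/
theorem integral_output_ge (hf : IsSubmodular f) (h0 : ∀ A, 0 ≤ f A) (hk : 1 ≤ k)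
    (hkn : k ≤ n) (hq : q ≤ n) {s : ℝ} (hs : s = k * q / n) (hs0 : 0 < s) {η : ℝ} (hη0 : 0 ≤ η)
    (hη : η ≤ 1) (hmin : ∀ O : Finset (Fin n), O.card = k →
      (1 - η) * s ≤ subsetAvg q (fun M => min ((M ∩ O).card : ℝ) s)) {ξ : ℝ} (hξ : 0 ≤ ξ)
    {Sopt : Finset (Fin n)} (hopt : IsOptimal f k Sopt) (hν : IsRewardLaw k f ν) (hm : 1 ≤ m)
    (hmm : m ≤ m') {r : ℕ} (hr : 1 ≤ r) :
    (1 - η) * (Real.exp 1)⁻¹ * f Sopt - 4 * k * ξ -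
        (k * (1 + q) : ℕ) * (2 * Real.exp (-(2 * (m * r) * ξ ^ 2))) ≤
      ∫ ω, f (rsRun s m r ω.1 ω.2.1 ω.2.2).2 ∂(jointLaw k q m m' ν) := by
  set N := k * (1 + q)
  have hc := integral_clippedOutput_ge (m := m) (m' := m') (ν := ν) hf h0 hk hkn hq hs hs0 hη0 hη
    hmin hξ hopt r
  set B : Set ((Fin m' × ℕ → Finset (Fin n) → ℝ) × (ℕ → Finset (Fin m')) ×
      (Fin k → Finset (Fin n) × ℝ)) := ⋃ j ∈ Finset.range N, badRound f s m r ξ j with hB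
  have hBm : MeasurableSet B :=
    Finset.measurableSet_biUnion _ fun j _ => measurableSet_badRound f s m r ξ j
  have hBle : (jointLaw k q m m' ν).real B ≤ N * (2 * Real.exp (-(2 * (m * r) * ξ ^ 2))) := by
    refine (measureReal_biUnion_finset_le _ _).trans ?_
    refine (Finset.sum_le_sum fun j _ => measureReal_badRound_le hν s hm hmm hr hξ j).trans ?_
    simp
  have hcard1 : ∀ (x : Fin m' × ℕ → Finset (Fin n) → ℝ) σ (z : Fin k → Finset (Fin n) × ℝ),
      (clippedOutput f ξ s m r x σ z).card ≤ k := by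
    intro x σ z
    have h := (card_transcript_rsLoop (clipAnswers f ξ (estimate m r x σ)) s (List.ofFn z) ∅ 0).2
    simp only [Finset.card_empty, List.length_ofFn, zero_add] at h
    exact h
  have hpt : ∀ᵐ ω ∂(jointLaw k q m m' ν), f (clippedOutput f ξ s m r ω.1 ω.2.1 ω.2.2) -
      B.indicator (fun _ => (1 : ℝ)) ω ≤ f (rsRun s m r ω.1 ω.2.1 ω.2.2).2 := by
    filter_upwards [ae_length_rsRun (ν := ν) (m := m) (m' := m') (k := k) hq s r] with ω hlen
    by_cases hω : ω ∈ B
    · rw [Set.indicator_of_mem hω]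
      have h1 := (mem_Icc_of_isRewardLaw hν (hcard1 ω.1 ω.2.1 ω.2.2)).2
      have h2 := h0 (rsRun s m r ω.1 ω.2.1 ω.2.2).2
      linarith
    · rw [Set.indicator_of_notMem hω, sub_zero]
      apply le_of_eq
      congr 1
      have hgood : ∀ j < N, |estimate m r ω.1 ω.2.1 j (played s m r ω.1 ω.2.1 ω.2.2 (j * r)) -
          f (played s m r ω.1 ω.2.1 ω.2.2 (j * r))| ≤ ξ := by
        intro j hj
        by_contra hcon
        refine hω (Set.mem_biUnion (Finset.mem_coe.2 (Finset.mem_range.2 hj)) ?_)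
        exact (not_le.1 hcon).le
      have hcongr := getD_transcript_congr (ans := estimate m r ω.1 ω.2.1)
        (ans' := clipAnswers f ξ (estimate m r ω.1 ω.2.1)) (rsLoop s (List.ofFn ω.2.2) ∅) 0 N
        (by
          intro j hj A hA
          rw [zero_add]
          refine (clipAnswers_eq ?_).symm
          have h := hgood j hj
          have hpl : played s m r ω.1 ω.2.1 ω.2.2 (j * r) = A := by
            unfold played
            rw [Nat.mul_div_cancel _ (by omega), List.getD_eq_getElem?_getD]
            have hA' : (rsRun s m r ω.1 ω.2.1 ω.2.2).1[j]? = some A := hA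
            rw [hA']; rfl
          rwa [hpl] at h)
      -- There is no query of index `N` in either run, so the default of `getD` at `N` is the
      -- output.
      have hlen' : ((rsLoop s (List.ofFn ω.2.2) ∅).transcript (estimate m r ω.1 ω.2.1) 0).1[N]? =
          none := List.getElem?_eq_none hlen.le
      have hl2 := hcongr.1.symm.trans hlen'
      have h3 := hcongr.2
      rw [List.getD_eq_getElem?_getD, List.getD_eq_getElem?_getD, hlen', hl2] at h3
      exact h3.symm
  have hi1 := integrable_comp_finset (jointLaw k q m m' ν)
    (measurable_clippedOutput (m' := m') (k := k) f ξ s m r) f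
  have hi2 : Integrable (B.indicator fun _ => (1 : ℝ)) (jointLaw k q m m' ν) :=
    (integrable_const 1).indicator hBm
  have hi3 := integrable_comp_finset (jointLaw k q m m' ν)
    (measurable_rsRun (m' := m') (k := k) (n := n) s m r Prod.snd) f
  have h4 := integral_mono_ae (hi1.sub hi2) hi3 hpt
  rw [integral_sub' hi1 hi2, integral_indicator_const _ hBm, smul_eq_mul, mul_one] at h4
  linarith

/-! ### The regret -/

theorem integrable_reward_of_measurable (hν : IsRewardLaw k f ν) (p : Fin m' × ℕ)
    {Z : (Fin m' × ℕ → Finset (Fin n) → ℝ) × (ℕ → Finset (Fin m')) ×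
      (Fin k → Finset (Fin n) × ℝ) → Finset (Fin n)} (hZ : Measurable Z)
    (hZk : ∀ ω, (Z ω).card ≤ k) :
    Integrable (fun ω => ω.1 p (Z ω)) (jointLaw k q m m' ν) := by
  have h1 : Measurable fun y : Finset (Fin n) × (Fin m' × ℕ → Finset (Fin n) → ℝ) =>
      y.2 p y.1 := measurable_from_prod_countable_right fun A => measurable_reward p A
  have h2 := h1.comp (hZ.prodMk measurable_fst)
  refine Integrable.of_bound h2.aestronglyMeasurable 1 ?_
  have h3 : ∀ᵐ ω ∂(jointLaw k q m m' ν), ∀ A : Finset (Fin n), A.card ≤ k →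
      ω.1 p A ∈ Set.Icc (0 : ℝ) 1 := Measure.quasiMeasurePreserving_fst.ae (ae_reward_mem hν p)
  filter_upwards [h3] with ω hω
  have h4 := hω (Z ω) (hZk ω)
  change ‖ω.1 p (Z ω)‖ ≤ 1
  rw [Real.norm_eq_abs, abs_of_nonneg h4.1]
  exact h4.2

theorem integral_joint_reward_played (hν : IsRewardLaw k f ν) (s : ℝ) (r t : ℕ) (i : Fin m') :
    ∫ ω, ω.1 (i, t) (played s m r ω.1 ω.2.1 ω.2.2 t) ∂(jointLaw k q m m' ν) =
      ∫ ω, f (played s m r ω.1 ω.2.1 ω.2.2 t) ∂(jointLaw k q m m' ν) := by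
  have hp := measurable_played (m' := m') (k := k) (n := n) s m r t
  have h1 := integrable_reward_of_measurable (q := q) (m := m) hν (i, t) hp
    fun ω => card_played_le s m r ω.1 ω.2.1 ω.2.2 t
  have h2 := integrable_comp_finset (jointLaw k q m m' ν) hp f
  unfold jointLaw at h1 h2 ⊢
  rw [integral_prod_symm _ h1, integral_prod_symm _ h2]
  exact integral_congr_ae (Filter.Eventually.of_forall fun w =>
    integral_reward_played hν s m r t i w.1 w.2)

theorem integral_joint_reward_const (hν : IsRewardLaw k f ν) (p : Fin m' × ℕ)
    {A : Finset (Fin n)} (hA : A.card ≤ k) :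
    ∫ ω, ω.1 p A ∂(jointLaw k q m m' ν) = f A := by
  have h1 := integrable_reward_of_measurable (q := q) (m := m) hν p
    (Z := fun _ => A) measurable_const fun _ => hA
  unfold jointLaw at h1 ⊢
  rw [integral_prod_symm _ h1]
  simp [integral_reward hν p hA]

/-- The regret of agent `i`. -/
def rsRegret (α s : ℝ) (m r T : ℕ) (Sopt : Finset (Fin n)) (i : Fin m')
    (ω : (Fin m' × ℕ → Finset (Fin n) → ℝ) × (ℕ → Finset (Fin m')) ×
      (Fin k → Finset (Fin n) × ℝ)) : ℝ :=
  ∑ t ∈ Finset.range T,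
    (α * ω.1 (i, t) Sopt - ω.1 (i, t) (played s m r ω.1 ω.2.1 ω.2.2 t))

theorem integrable_regret_term (hν : IsRewardLaw k f ν) (α s : ℝ) (r t : ℕ) (i : Fin m')
    {Sopt : Finset (Fin n)} (hS : Sopt.card ≤ k) :
    Integrable (fun ω => α * ω.1 (i, t) Sopt - ω.1 (i, t) (played s m r ω.1 ω.2.1 ω.2.2 t))
      (jointLaw k q m m' ν) :=
  ((integrable_reward_of_measurable hν (i, t) (Z := fun _ => Sopt) measurable_const
    fun _ => hS).const_mul α).sub
    (integrable_reward_of_measurable hν (i, t)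
      (measurable_played s m r t) fun ω => card_played_le s m r ω.1 ω.2.1 ω.2.2 t)

theorem integrable_rsRegret (hν : IsRewardLaw k f ν) (α s : ℝ) (r T : ℕ) (i : Fin m')
    {Sopt : Finset (Fin n)} (hS : Sopt.card ≤ k) :
    Integrable (rsRegret α s m r T Sopt i) (jointLaw k q m m' ν) :=
  integrable_finsetSum _ fun t _ => integrable_regret_term hν α s r t i hS

theorem integral_rsRegret (hν : IsRewardLaw k f ν) (α s : ℝ) (r T : ℕ) (i : Fin m')
    {Sopt : Finset (Fin n)} (hS : Sopt.card ≤ k) :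
    ∫ ω, rsRegret α s m r T Sopt i ω ∂(jointLaw k q m m' ν) =
      ∑ t ∈ Finset.range T, (α * f Sopt -
        ∫ ω, f (played s m r ω.1 ω.2.1 ω.2.2 t) ∂(jointLaw k q m m' ν)) := by
  unfold rsRegret
  rw [integral_finsetSum _ fun t _ => integrable_regret_term hν α s r t i hS]
  refine Finset.sum_congr rfl fun t _ => ?_
  rw [integral_sub ((integrable_reward_of_measurable hν (i, t) (Z := fun _ => Sopt)
      measurable_const fun _ => hS).const_mul α)
    (integrable_reward_of_measurable hν (i, t)
      (measurable_played s m r t) fun ω => card_played_le s m r ω.1 ω.2.1 ω.2.2 t),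
    integral_const_mul, integral_joint_reward_const hν (i, t) hS,
    integral_joint_reward_played hν]

theorem integral_rsRegret_le_horizon (hν : IsRewardLaw k f ν) (h0 : ∀ A, 0 ≤ f A) {α : ℝ}
    (hα0 : 0 ≤ α) (hα1 : α ≤ 1) (s : ℝ) (r T : ℕ) (i : Fin m') {Sopt : Finset (Fin n)}
    (hS : Sopt.card ≤ k) :
    ∫ ω, rsRegret α s m r T Sopt i ω ∂(jointLaw k q m m' ν) ≤ T := by
  rw [integral_rsRegret hν α s r T i hS]
  have h1 := mem_Icc_of_isRewardLaw hν hS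
  refine (Finset.sum_le_sum (g := fun _ => (1 : ℝ)) fun t _ => ?_).trans (by simp)
  have h2 : 0 ≤ ∫ ω, f (played s m r ω.1 ω.2.1 ω.2.2 t) ∂(jointLaw k q m m' ν) :=
    integral_nonneg fun ω => h0 _
  nlinarith [h1.1, h1.2]

/-- Each of the first `N r` steps costs at most `1`; from then on the output is played almost surely
and every step costs at most `D`. -/
theorem integral_rsRegret_le (hν : IsRewardLaw k f ν) (h0 : ∀ A, 0 ≤ f A) {α : ℝ}
    (hα0 : 0 ≤ α) (hα1 : α ≤ 1) (hq : q ≤ n) (s : ℝ) {r : ℕ} (hr : 1 ≤ r) (T : ℕ) (i : Fin m')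
    {Sopt : Finset (Fin n)} (hS : Sopt.card ≤ k) {D : ℝ} (hD0 : 0 ≤ D)
    (hD : α * f Sopt - ∫ ω, f (rsRun s m r ω.1 ω.2.1 ω.2.2).2 ∂(jointLaw k q m m' ν) ≤ D) :
    ∫ ω, rsRegret α s m r T Sopt i ω ∂(jointLaw k q m m' ν) ≤
      (k * (1 + q) * r : ℕ) + T * D := by
  classical
  rw [integral_rsRegret hν α s r T i hS]
  have h1 := mem_Icc_of_isRewardLaw hν hS
  set N := k * (1 + q)
  have hterm : ∀ t ∈ Finset.range T, α * f Sopt -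
      ∫ ω, f (played s m r ω.1 ω.2.1 ω.2.2 t) ∂(jointLaw k q m m' ν) ≤
        (if t < N * r then 1 else 0) + D := by
    intro t _
    split_ifs with ht
    · have h2 : 0 ≤ ∫ ω, f (played s m r ω.1 ω.2.1 ω.2.2 t) ∂(jointLaw k q m m' ν) :=
        integral_nonneg fun ω => h0 _
      nlinarith [h1.1, h1.2]
    · have h3 : ∫ ω, f (played s m r ω.1 ω.2.1 ω.2.2 t) ∂(jointLaw k q m m' ν) =
          ∫ ω, f (rsRun s m r ω.1 ω.2.1 ω.2.2).2 ∂(jointLaw k q m m' ν) := by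
        refine integral_congr_ae ?_
        filter_upwards [ae_length_rsRun (ν := ν) (m := m) (m' := m') (k := k) hq s r] with ω hlen
        unfold played
        rw [List.getD_eq_getElem?_getD, List.getElem?_eq_none]
        · rfl
        · rw [hlen, Nat.le_div_iff_mul_le (by omega)]
          exact not_lt.1 ht
      rw [h3]
      linarith
  refine (Finset.sum_le_sum hterm).trans ?_
  rw [Finset.sum_add_distrib]
  refine add_le_add ?_ (by simp)
  rw [← Finset.sum_filter, Finset.sum_const, nsmul_eq_mul, mul_one]
  refine Nat.cast_le.2 ((Finset.card_le_card (t := Finset.range (N * r)) ?_).trans (by simp))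
  intro t ht
  simpa using (Finset.mem_filter.1 ht).2

end JointLaw

/-! ### The parameters -/

section Parameters

/-- The unrounded number of plays per round. -/
def idealPlays (K M N T : ℝ) : ℝ :=
  M⁻¹ * (K * √(Real.log T) * ((T * M) / N) ^ (1 / (2 + 1) : ℝ)) ^ ((2 + 2 * 2) / (3 + 2) : ℝ)

/-! ### Balancing the unrounded parameters. -/

section Ideal

variable {K M N T : ℝ}

theorem idealPlays_pos (hK : 0 < K) (hM : 0 < M) (hN : 0 < N) (hT : 1 < T) :
    0 < idealPlays K M N T := by
  have := Real.log_pos hT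
  unfold idealPlays
  positivity

/-- The cost `T ε` at the unrounded number of plays. It has the same value as the estimation cost in
`mul_sqrt_idealPlays`, which explains the exponent `6/5` in the number of plays. -/
theorem mul_rpow_idealPlays (hK : 0 < K) (hM : 0 < M) (hN : 0 < N) (hT : 1 < T) :
    T * (N * idealPlays K M N T / T) ^ (1 / (2 + 1) : ℝ) =
      K ^ (2 / 5 : ℝ) * Real.log T ^ (1 / 5 : ℝ) *
        (M ^ (-(1 / 5) : ℝ) * N ^ (1 / 5 : ℝ) * T ^ (4 / 5 : ℝ)) := by
  have hL := Real.log_pos hT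
  unfold idealPlays
  generalize Real.log T = L at *
  have hT0 : 0 < T := by linarith
  -- Writing every positive quantity as an exponential, with `log T` treated as an independent
  -- variable, turns the identity into a linear one between exponents.
  obtain ⟨a, rfl⟩ : ∃ a, K = Real.exp a := ⟨_, (Real.exp_log hK).symm⟩
  obtain ⟨b, rfl⟩ : ∃ a, M = Real.exp a := ⟨_, (Real.exp_log hM).symm⟩
  obtain ⟨c, rfl⟩ : ∃ a, N = Real.exp a := ⟨_, (Real.exp_log hN).symm⟩
  obtain ⟨d, rfl⟩ : ∃ a, T = Real.exp a := ⟨_, (Real.exp_log hT0).symm⟩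
  obtain ⟨e, rfl⟩ : ∃ a, L = Real.exp a := ⟨_, (Real.exp_log hL).symm⟩
  simp only [Real.sqrt_eq_rpow, ← Real.exp_mul, ← Real.exp_add, ← Real.exp_sub, ← Real.exp_neg]
  congr 1
  ring

theorem mul_sqrt_idealPlays (hK : 0 < K) (hM : 0 < M) (hN : 0 < N) (hT : 1 < T) :
    K * T * √(Real.log T / (M * idealPlays K M N T)) =
      K ^ (2 / 5 : ℝ) * Real.log T ^ (1 / 5 : ℝ) *
        (M ^ (-(1 / 5) : ℝ) * N ^ (1 / 5 : ℝ) * T ^ (4 / 5 : ℝ)) := by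
  have hL := Real.log_pos hT
  unfold idealPlays
  generalize Real.log T = L at *
  have hT0 : 0 < T := by linarith
  obtain ⟨a, rfl⟩ : ∃ a, K = Real.exp a := ⟨_, (Real.exp_log hK).symm⟩
  obtain ⟨b, rfl⟩ : ∃ a, M = Real.exp a := ⟨_, (Real.exp_log hM).symm⟩
  obtain ⟨c, rfl⟩ : ∃ a, N = Real.exp a := ⟨_, (Real.exp_log hN).symm⟩
  obtain ⟨d, rfl⟩ : ∃ a, T = Real.exp a := ⟨_, (Real.exp_log hT0).symm⟩
  obtain ⟨e, rfl⟩ : ∃ a, L = Real.exp a := ⟨_, (Real.exp_log hL).symm⟩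
  simp only [Real.sqrt_eq_rpow, ← Real.exp_mul, ← Real.exp_add, ← Real.exp_sub, ← Real.exp_neg]
  congr 1
  ring

theorem idealPlays_eq (hK : 0 < K) (hM : 0 < M) (hN : 0 < N) (hT : 1 < T) :
    idealPlays K M N T =
      Real.log T ^ (3 / 5 : ℝ) * (T / (N * M ^ (3 / 2 : ℝ) / K ^ (3 : ℝ))) ^ (2 / 5 : ℝ) := by
  have hL := Real.log_pos hT
  unfold idealPlays
  generalize Real.log T = L at *
  have hT0 : 0 < T := by linarith
  obtain ⟨a, rfl⟩ : ∃ a, K = Real.exp a := ⟨_, (Real.exp_log hK).symm⟩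
  obtain ⟨b, rfl⟩ : ∃ a, M = Real.exp a := ⟨_, (Real.exp_log hM).symm⟩
  obtain ⟨c, rfl⟩ : ∃ a, N = Real.exp a := ⟨_, (Real.exp_log hN).symm⟩
  obtain ⟨d, rfl⟩ : ∃ a, T = Real.exp a := ⟨_, (Real.exp_log hT0).symm⟩
  obtain ⟨e, rfl⟩ : ∃ a, L = Real.exp a := ⟨_, (Real.exp_log hL).symm⟩
  simp only [Real.sqrt_eq_rpow, ← Real.exp_mul, ← Real.exp_add, ← Real.exp_sub, ← Real.exp_neg]
  congr 1
  ring

theorem half_lt_log (hT : 2 ≤ T) : 1 / 2 < Real.log T := by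
  have h1 := Real.log_two_gt_d9
  have h2 := Real.log_le_log (by norm_num) hT
  linarith

/-- The sole use of the lower bound on the horizon: rounding the number of plays up then costs only
a constant factor. The bound is `1/2` and not `1` because `log T` may be smaller than `1`. -/
theorem half_le_idealPlays (hK : 0 < K) (hM : 0 < M) (hN : 0 < N) (hT : 2 ≤ T)
    (h : N * M ^ (3 / 2 : ℝ) / K ^ 3 ≤ T) : 1 / 2 ≤ idealPlays K M N T := by
  have hL := half_lt_log hT
  rw [idealPlays_eq hK hM hN (by linarith)]
  have h1 : (1 : ℝ) ≤ (T / (N * M ^ (3 / 2 : ℝ) / K ^ (3 : ℝ))) ^ (2 / 5 : ℝ) := by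
    refine Real.one_le_rpow ?_ (by norm_num)
    have e : K ^ (3 : ℝ) = K ^ 3 := by norm_cast
    rw [e, le_div_iff₀ (by positivity), one_mul]
    exact h
  have h2 : 1 / 2 ≤ Real.log T ^ (3 / 5 : ℝ) := by
    rcases le_total 1 (Real.log T) with h3 | h3
    · linarith [Real.one_le_rpow h3 (by norm_num : (0 : ℝ) ≤ 3 / 5)]
    · have := Real.rpow_le_rpow_of_exponent_ge (by linarith) h3
        (by norm_num : (3 / 5 : ℝ) ≤ 1)
      rw [Real.rpow_one] at this
      linarith
  nlinarith

end Ideal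

variable {n k m T : ℕ}

/-- The accuracy of the subroutine. -/
def rsAccuracy (n k m T : ℕ) : ℝ :=
  ((n : ℝ) * rsPlays n k m T / T) ^ (1 / (2 + 1) : ℝ)

theorem accuracy_eq : accuracy 2 1 n (4 * k) m T = rsAccuracy n k m T := by
  unfold accuracy rsAccuracy rsPlays
  rw [if_pos (Or.inl two_pos)]

theorem rsPlays_eq : rsPlays n k m T = ⌈idealPlays (4 * k) m n T⌉₊ := rfl

theorem rsAccuracy_cube (hT : 2 ≤ T) : T * rsAccuracy n k m T ^ 3 = n * rsPlays n k m T := by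
  have hT0 : (0 : ℝ) < T := by positivity
  unfold rsAccuracy
  rw [← Real.rpow_natCast, ← Real.rpow_mul (by positivity)]
  norm_num
  field_simp

/-- The rate of the regret, up to logarithmic factors. -/
def regretRate (n k m T : ℕ) : ℝ :=
  (m : ℝ) ^ (-(1 / 5) : ℝ) * (k : ℝ) ^ (2 / 5 : ℝ) * (n : ℝ) ^ (1 / 5 : ℝ) *
    (T : ℝ) ^ (4 / 5 : ℝ)

theorem rate_le (hT : 2 ≤ T) : ((4 * k : ℝ)) ^ (2 / 5 : ℝ) * Real.log T ^ (1 / 5 : ℝ) *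
      ((m : ℝ) ^ (-(1 / 5) : ℝ) * (n : ℝ) ^ (1 / 5 : ℝ) * (T : ℝ) ^ (4 / 5 : ℝ)) ≤
    4 * Real.log T * regretRate n k m T := by
  have hL := half_lt_log (T := T) (by exact_mod_cast hT)
  have h1 : ((4 : ℝ)) ^ (2 / 5 : ℝ) ≤ 2 := by
    have h := Real.rpow_le_rpow_of_exponent_le (by norm_num : (1 : ℝ) ≤ 4)
      (by norm_num : (2 / 5 : ℝ) ≤ 1 / 2)
    refine h.trans (le_of_eq ?_)
    rw [← Real.sqrt_eq_rpow, show (4 : ℝ) = 2 ^ 2 by norm_num]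
    exact Real.sqrt_sq (by norm_num)
  have h2 : Real.log T ^ (1 / 5 : ℝ) ≤ 2 * Real.log T := by
    rcases le_total 1 (Real.log T) with h3 | h3
    · have := Real.rpow_le_rpow_of_exponent_le h3 (by norm_num : (1 / 5 : ℝ) ≤ 1)
      rw [Real.rpow_one] at this
      linarith
    · have := Real.rpow_le_one (by linarith) h3 (by norm_num : (0 : ℝ) ≤ 1 / 5)
      linarith
  rw [Real.mul_rpow (by norm_num) k.cast_nonneg]
  unfold regretRate
  calc (4 : ℝ) ^ (2 / 5 : ℝ) * (k : ℝ) ^ (2 / 5 : ℝ) * Real.log T ^ (1 / 5 : ℝ) *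
      ((m : ℝ) ^ (-(1 / 5) : ℝ) * (n : ℝ) ^ (1 / 5 : ℝ) * (T : ℝ) ^ (4 / 5 : ℝ))
      ≤ 2 * (k : ℝ) ^ (2 / 5 : ℝ) * (2 * Real.log T) *
      ((m : ℝ) ^ (-(1 / 5) : ℝ) * (n : ℝ) ^ (1 / 5 : ℝ) * (T : ℝ) ^ (4 / 5 : ℝ)) := by
        gcongr
    _ = _ := by ring

/-! ### Bounds for the rounded parameters. -/

section Positive

variable (hk : 1 ≤ k) (hkn : k ≤ n) (hm : 1 ≤ m) (hT : 2 ≤ T)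
include hk hkn hm hT

theorem idealPlays_nat_pos : 0 < idealPlays (4 * k) m n T := by
  have : 1 ≤ n := hk.trans hkn
  exact idealPlays_pos (by positivity) (by positivity) (by positivity) (by exact_mod_cast hT)

theorem one_le_rsPlays : 1 ≤ rsPlays n k m T := by
  rw [rsPlays_eq, Nat.one_le_ceil_iff]
  exact idealPlays_nat_pos hk hkn hm hT

theorem rsAccuracy_pos : 0 < rsAccuracy n k m T := by
  have h1 := one_le_rsPlays hk hkn hm hT
  have : 1 ≤ n := hk.trans hkn
  unfold rsAccuracy
  positivity

theorem rpow_le_rsAccuracy : (T : ℝ) ^ (-(1 / 3) : ℝ) ≤ rsAccuracy n k m T := by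
  have h1 := one_le_rsPlays hk hkn hm hT
  have hn : 1 ≤ n := hk.trans hkn
  have hT0 : (0 : ℝ) < T := by positivity
  have h2 : (1 : ℝ) ≤ n * rsPlays n k m T := by exact_mod_cast Nat.mul_le_mul hn h1
  unfold rsAccuracy
  rw [Real.rpow_neg hT0.le, ← Real.inv_rpow hT0.le]
  norm_num
  refine Real.rpow_le_rpow (by positivity) ?_ (by norm_num)
  rw [inv_eq_one_div]
  gcongr

theorem inv_sq_rsAccuracy_le : (rsAccuracy n k m T ^ 2)⁻¹ ≤ (T : ℝ) ^ (2 / 3 : ℝ) := by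
  have hT0 : (0 : ℝ) < T := by positivity
  have h := rpow_le_rsAccuracy hk hkn hm hT
  have h1 : ((T : ℝ) ^ (-(1 / 3) : ℝ)) ^ 2 ≤ rsAccuracy n k m T ^ 2 := by
    gcongr
  have h2 : ((T : ℝ) ^ (-(1 / 3) : ℝ)) ^ 2 = ((T : ℝ) ^ (2 / 3 : ℝ))⁻¹ := by
    rw [← Real.rpow_natCast, ← Real.rpow_mul hT0.le, ← Real.rpow_neg hT0.le]
    norm_num
  rw [h2] at h1
  exact inv_le_of_inv_le₀ (by positivity) h1

theorem log_two_div_rsAccuracy_le : Real.log (2 / rsAccuracy n k m T) ≤ 2 * Real.log T := by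
  have hT0 : (0 : ℝ) < T := by positivity
  have hε := rsAccuracy_pos hk hkn hm hT
  have h := Real.log_le_log (by positivity) (rpow_le_rsAccuracy hk hkn hm hT)
  rw [Real.log_rpow hT0] at h
  rw [Real.log_div (by norm_num) hε.ne']
  have h2 : Real.log 2 ≤ Real.log T := Real.log_le_log (by norm_num) (by exact_mod_cast hT)
  have h3 := half_lt_log (T := T) (by exact_mod_cast hT)
  linarith

theorem card_queries_le :
    ((k * (1 + rsSampleSize n k (rsAccuracy n k m T)) : ℕ) : ℝ) ≤
      2 * k + 16 * Real.log T * n * (rsAccuracy n k m T ^ 2)⁻¹ := by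
  have hk0 : (0 : ℝ) < k := by exact_mod_cast hk
  have hL := half_lt_log (T := T) (by exact_mod_cast hT)
  have hε := rsAccuracy_pos hk hkn hm hT
  set ε := rsAccuracy n k m T
  have h1 : (rsSampleSize n k ε : ℝ) ≤
      8 * (k : ℝ)⁻¹ * (ε ^ 2)⁻¹ * (2 * Real.log T) * n + 1 := by
    refine (Nat.cast_le.2 (min_le_left _ _)).trans ?_
    refine (Nat.cast_le.2 (Nat.ceil_mono (b := 8 * (k : ℝ)⁻¹ * (ε ^ 2)⁻¹ * (2 * Real.log T) * n)
      ?_)).trans (Nat.ceil_lt_add_one (by positivity)).le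
    gcongr
    exact log_two_div_rsAccuracy_le hk hkn hm hT
  push_cast
  calc (k : ℝ) * (1 + rsSampleSize n k ε)
      ≤ k * (1 + (8 * (k : ℝ)⁻¹ * (ε ^ 2)⁻¹ * (2 * Real.log T) * n + 1)) := by gcongr
    _ = 2 * k + 16 * Real.log T * n * (ε ^ 2)⁻¹ := by field_simp; ring

theorem card_queries_le_horizon :
    ((k * (1 + rsSampleSize n k (rsAccuracy n k m T)) : ℕ) : ℝ) ≤
      20 * Real.log T ^ (1 : ℝ) * (n * (T : ℝ) ^ (2 / 3 : ℝ)) := by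
  refine (card_queries_le hk hkn hm hT).trans ?_
  have hL := half_lt_log (T := T) (by exact_mod_cast hT)
  have h1 := inv_sq_rsAccuracy_le hk hkn hm hT
  have h2 : (1 : ℝ) ≤ (T : ℝ) ^ (2 / 3 : ℝ) :=
    Real.one_le_rpow (by exact_mod_cast (by omega : 1 ≤ T)) (by norm_num)
  have hkn' : (k : ℝ) ≤ n := by exact_mod_cast hkn
  have hn0 : (0 : ℝ) ≤ n := n.cast_nonneg
  rw [Real.rpow_one]
  have h3 : 16 * Real.log T * n * (rsAccuracy n k m T ^ 2)⁻¹ ≤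
      16 * Real.log T * n * (T : ℝ) ^ (2 / 3 : ℝ) := by gcongr
  have h4 : (k : ℝ) ≤ n * (T : ℝ) ^ (2 / 3 : ℝ) := by nlinarith
  have h5 : 2 * (k : ℝ) ≤ 4 * Real.log T * (n * (T : ℝ) ^ (2 / 3 : ℝ)) := by nlinarith
  linarith

/-- The relation `n r = T ε³` turns the main term `n r ε⁻²` into `T ε`; the remaining `2 k r` is at
most `2 n r = 2 T ε³ ≤ 2 T ε`. -/
theorem card_queries_mul_rsPlays_le (hε1 : rsAccuracy n k m T ≤ 1) :
    ((k * (1 + rsSampleSize n k (rsAccuracy n k m T)) * rsPlays n k m T : ℕ) : ℝ) ≤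
      (2 + 16 * Real.log T) * (T * rsAccuracy n k m T) := by
  have hε := rsAccuracy_pos hk hkn hm hT
  have hc := rsAccuracy_cube (n := n) (k := k) (m := m) hT
  have hL := half_lt_log (T := T) (by exact_mod_cast hT)
  have hT0 : (0 : ℝ) < T := by positivity
  have h1 := card_queries_le hk hkn hm hT
  set ε := rsAccuracy n k m T
  set r := rsPlays n k m T
  have hr0 : (0 : ℝ) ≤ r := r.cast_nonneg
  have hkr : (k : ℝ) * r ≤ T * ε := by
    have : (k : ℝ) * r ≤ n * r := by gcongr
    rw [← hc] at this
    have h2 : ε ^ 3 ≤ ε := by nlinarith [sq_nonneg ε, mul_pos hε hε]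
    nlinarith
  have e : 16 * Real.log T * n * (ε ^ 2)⁻¹ * r = 16 * Real.log T * (T * ε) := by
    have : 16 * Real.log T * n * (ε ^ 2)⁻¹ * r = 16 * Real.log T * (ε ^ 2)⁻¹ * (n * r) := by ring
    rw [this, ← hc]
    field_simp
  rw [Nat.cast_mul]
  have h3 := mul_le_mul_of_nonneg_right h1 hr0
  rw [add_mul, e] at h3
  nlinarith

theorem one_le_horizon_mul_rsAccuracy : 1 ≤ T * rsAccuracy n k m T := by
  have hT1 : (1 : ℝ) ≤ T := by exact_mod_cast (by omega : 1 ≤ T)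
  have hT0 : (0 : ℝ) < T := by positivity
  have h1 := mul_le_mul_of_nonneg_left (rpow_le_rsAccuracy hk hkn hm hT) hT0.le
  refine le_trans ?_ h1
  have : (T : ℝ) * (T : ℝ) ^ (-(1 / 3) : ℝ) = (T : ℝ) ^ (2 / 3 : ℝ) := by
    nth_rewrite 1 [← Real.rpow_one (T : ℝ)]
    rw [← Real.rpow_add hT0]
    norm_num
  rw [this]
  exact Real.one_le_rpow hT1 (by norm_num)

theorem horizon_mul_rsAccuracy_le
    (h : (n : ℝ) * (m : ℝ) ^ (3 / 2 : ℝ) / (4 * k) ^ 3 ≤ T) :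
    T * rsAccuracy n k m T ≤ 8 * Real.log T * regretRate n k m T := by
  have hn : 1 ≤ n := hk.trans hkn
  have hx := idealPlays_nat_pos hk hkn hm hT
  have hx2 := half_le_idealPlays (K := 4 * k) (M := m) (N := n) (T := T) (by positivity)
    (by positivity) (by positivity) (by exact_mod_cast hT) h
  -- Since the unrounded value is at least `1/2`, the factor `3` would do; `8` has cube root `2`.
  have hr : (rsPlays n k m T : ℝ) ≤ 8 * idealPlays (4 * k) m n T := by
    rw [rsPlays_eq]
    have := (Nat.ceil_lt_add_one hx.le).le
    linarith
  have h1 := mul_rpow_idealPlays (K := 4 * k) (M := m) (N := n) (T := T) (by positivity)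
    (by positivity) (by positivity) (by exact_mod_cast hT)
  have h2 := rate_le (n := n) (k := k) (m := m) hT
  rw [← h1] at h2
  set x := idealPlays (4 * k) m n T
  have hT0 : (0 : ℝ) < T := by positivity
  have h8 : (8 : ℝ) ^ (1 / (2 + 1) : ℝ) = 2 := by
    rw [show (8 : ℝ) = 2 ^ (3 : ℝ) by norm_num, ← Real.rpow_mul (by norm_num)]
    norm_num
  have h3 : rsAccuracy n k m T ≤ 2 * ((n : ℝ) * x / T) ^ (1 / (2 + 1) : ℝ) := by
    unfold rsAccuracy
    calc ((n : ℝ) * rsPlays n k m T / T) ^ (1 / (2 + 1) : ℝ)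
        ≤ (8 * ((n : ℝ) * x / T)) ^ (1 / (2 + 1) : ℝ) := ?_
      _ = 2 * ((n : ℝ) * x / T) ^ (1 / (2 + 1) : ℝ) := by
        rw [Real.mul_rpow (by norm_num) (by positivity), h8]
    refine Real.rpow_le_rpow (by positivity) ?_ (by norm_num)
    calc (n : ℝ) * rsPlays n k m T / T ≤ n * (8 * x) / T := by gcongr
      _ = 8 * (n * x / T) := by ring
  nlinarith

/-- The deviation of the estimates which is exceeded with probability at most `2 T⁻²`. -/
def deviation (n k m T : ℕ) : ℝ := √(Real.log T / (m * rsPlays n k m T))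

/-- Rounding the number of plays up only decreases the deviation, so no lower bound on `T` beyond
`2` is needed. -/
theorem mul_deviation_le :
    T * (4 * k * deviation n k m T) ≤ 4 * Real.log T * regretRate n k m T := by
  have hn : 1 ≤ n := hk.trans hkn
  have hL := half_lt_log (T := T) (by exact_mod_cast hT)
  have hx := idealPlays_nat_pos hk hkn hm hT
  have h1 := mul_sqrt_idealPlays (K := 4 * k) (M := m) (N := n) (T := T) (by positivity)
    (by positivity) (by positivity) (by exact_mod_cast hT)
  have h2 := rate_le (n := n) (k := k) (m := m) hT
  rw [← h1] at h2
  have e : T * (4 * k * deviation n k m T) = 4 * k * T * deviation n k m T := by ring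
  rw [e]
  refine le_trans ?_ h2
  unfold deviation
  have hr : idealPlays (4 * k) m n T ≤ rsPlays n k m T := Nat.le_ceil _
  gcongr

theorem two_mul_deviation_sq :
    2 * ((m : ℝ) * rsPlays n k m T) * deviation n k m T ^ 2 = 2 * Real.log T := by
  have h1 := one_le_rsPlays hk hkn hm hT
  have hL := half_lt_log (T := T) (by exact_mod_cast hT)
  unfold deviation
  rw [Real.sq_sqrt (by positivity)]
  field_simp

end Positive

end Parameters

/-! ### The regret bound -/

section Bound

variable {n k m m' T : ℕ}

theorem rsSampleSize_le (n k : ℕ) (ε : ℝ) : rsSampleSize n k ε ≤ n := min_le_right _ _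

theorem rsSampleSize_pos (hk : 1 ≤ k) (hkn : k ≤ n) {ε : ℝ} (hε : 0 < ε) (hε1 : ε ≤ 1) :
    0 < rsSampleSize n k ε := by
  have hn : 1 ≤ n := hk.trans hkn
  have hlog : 0 < Real.log (2 / ε) := Real.log_pos (by rw [lt_div_iff₀ hε]; linarith)
  unfold rsSampleSize
  refine lt_min (Nat.ceil_pos.2 ?_) hn
  positivity

/-- If `q = n`, the sample is everything and the overlap equals `s = k`. Otherwise `s ≥ 8 ε⁻² log
(2/ε) ≥ (2/ε)²`, so the loss `√s / 2` from `subsetAvg_min_ge` is at most `ε s`. -/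
theorem avg_min_rsSampleSize_ge (hk : 1 ≤ k) (hkn : k ≤ n) {ε : ℝ} (hε : 0 < ε) (hε1 : ε ≤ 1)
    {O : Finset (Fin n)} (hO : O.card = k) :
    (1 - ε) * ((k : ℝ) * rsSampleSize n k ε / n) ≤ subsetAvg (rsSampleSize n k ε)
      (fun M => min ((M ∩ O).card : ℝ) ((k : ℝ) * rsSampleSize n k ε / n)) := by
  have hn : 1 ≤ n := hk.trans hkn
  have hn0 : (0 : ℝ) < n := by exact_mod_cast hn
  have hk0 : (0 : ℝ) < k := by exact_mod_cast hk
  have hq0 := rsSampleSize_pos hk hkn hε hε1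
  have hlog : 1 / 2 ≤ Real.log (2 / ε) :=
    (half_lt_log (by rw [le_div_iff₀ hε]; linarith)).le
  rcases le_total n ⌈8 * (k : ℝ)⁻¹ * (ε ^ 2)⁻¹ * Real.log (2 / ε) * n⌉₊ with h | h
  · have hq : rsSampleSize n k ε = n := min_eq_right h
    rw [hq]
    have hs : (k : ℝ) * n / n = k := by field_simp
    rw [hs, subsetAvg_congr (ψ := fun _ => (k : ℝ)), subsetAvg_const le_rfl]
    · nlinarith
    · intro M hM
      have : M = Finset.univ := Finset.eq_univ_of_card M (by simpa using hM)
      simp [this, hO]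
  · have hq : rsSampleSize n k ε = ⌈8 * (k : ℝ)⁻¹ * (ε ^ 2)⁻¹ * Real.log (2 / ε) * n⌉₊ :=
      min_eq_left h
    have hq' := Nat.le_ceil (8 * (k : ℝ)⁻¹ * (ε ^ 2)⁻¹ * Real.log (2 / ε) * n)
    rw [← hq] at hq'
    set q := rsSampleSize n k ε
    have hs0 : 0 < (k : ℝ) * q / n := by positivity
    have hge := subsetAvg_min_ge (rsSampleSize_le n k ε) hO rfl hs0
    refine le_trans ?_ hge
    set s := (k : ℝ) * q / n with hs
    have h4 : (2 / ε) ^ 2 ≤ s := by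
      rw [hs, le_div_iff₀ hn0]
      have h5 := mul_le_mul_of_nonneg_left hq' hk0.le
      have h6 : (k : ℝ) * (8 * (k : ℝ)⁻¹ * (ε ^ 2)⁻¹ * Real.log (2 / ε) * n) =
          8 * (ε ^ 2)⁻¹ * n * Real.log (2 / ε) := by field_simp
      have h7 : (2 / ε) ^ 2 * n = 8 * (ε ^ 2)⁻¹ * n * (1 / 2) := by
        rw [div_pow]; field_simp; norm_num
      have h8 : 8 * (ε ^ 2)⁻¹ * n * (1 / 2) ≤ 8 * (ε ^ 2)⁻¹ * n * Real.log (2 / ε) := by gcongr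
      linarith
    have h9 : 2 / ε ≤ √s := Real.le_sqrt_of_sq_le h4
    have h10 : √s * √s = s := Real.mul_self_sqrt hs0.le
    have h11 : 2 ≤ ε * √s := by rw [div_le_iff₀ hε] at h9; linarith
    nlinarith [Real.sqrt_pos.2 hs0]

theorem integral_rsRegret_rate_le (hk : 1 ≤ k) (hkn : k ≤ n) (hm : 1 ≤ m) (hmm : m ≤ m')
    (hT : 2 ≤ T) (h : (n : ℝ) * (m : ℝ) ^ (3 / 2 : ℝ) / (4 * k) ^ 3 ≤ T)
    {f : Finset (Fin n) → ℝ} {ν : Measure (Finset (Fin n) → ℝ)} [IsProbabilityMeasure ν]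
    (h0 : ∀ A, 0 ≤ f A) (hf : IsSubmodular f) (hν : IsRewardLaw k f ν)
    {Sopt : Finset (Fin n)} (hopt : IsOptimal f k Sopt) (i : Fin m') :
    ∫ ω, rsRegret (Real.exp 1)⁻¹
        ((k : ℝ) * rsSampleSize n k (rsAccuracy n k m T) / n) m (rsPlays n k m T) T Sopt i ω
        ∂(jointLaw k (rsSampleSize n k (rsAccuracy n k m T)) m m' ν) ≤
      400 * Real.log T ^ (2 : ℝ) * regretRate n k m T := by
  have hn0 : (0 : ℝ) < n := by exact_mod_cast hk.trans hkn
  have hk0 : (0 : ℝ) < k := by exact_mod_cast hk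
  have hT0 : (0 : ℝ) < T := by positivity
  have hL := half_lt_log (T := T) (by exact_mod_cast hT)
  have hε := rsAccuracy_pos hk hkn hm hT
  have hr := one_le_rsPlays hk hkn hm hT
  have hα0 : 0 ≤ (Real.exp 1)⁻¹ := by positivity
  have hα1 : (Real.exp 1)⁻¹ ≤ 1 := inv_le_one_of_one_le₀ (Real.one_le_exp zero_le_one)
  have hrate0 : 0 ≤ regretRate n k m T := by unfold regretRate; positivity
  have hb1 := horizon_mul_rsAccuracy_le hk hkn hm hT h
  have hb2 := mul_deviation_le hk hkn hm hT
  have hb3 := one_le_horizon_mul_rsAccuracy hk hkn hm hT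
  have htriv := integral_rsRegret_le_horizon (k := k)
    (q := rsSampleSize n k (rsAccuracy n k m T)) (m := m) hν h0 hα0 hα1
    ((k : ℝ) * rsSampleSize n k (rsAccuracy n k m T) / n) (rsPlays n k m T) T i hopt.1
  -- The constant `5` collects `2` from the exploration time, `1` from the accuracy and `2` from the
  -- failure probability, the last being absorbed through `1 ≤ T ε`.
  suffices hmain : ∫ ω, rsRegret (Real.exp 1)⁻¹
        ((k : ℝ) * rsSampleSize n k (rsAccuracy n k m T) / n) m (rsPlays n k m T) T Sopt i ω
        ∂(jointLaw k (rsSampleSize n k (rsAccuracy n k m T)) m m' ν) ≤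
      (5 + 16 * Real.log T) * (T * rsAccuracy n k m T) + T * (4 * k * deviation n k m T) by
    refine hmain.trans ?_
    have e2 : Real.log T ^ (2 : ℝ) = Real.log T ^ 2 := by norm_cast
    rw [e2]
    set W := regretRate n k m T
    set L := Real.log T
    have h1 : (5 + 16 * L) * (T * rsAccuracy n k m T) ≤ (5 + 16 * L) * (8 * L * W) := by gcongr
    have h2 : 0 ≤ L * W := by positivity
    nlinarith
  have hdev0 : 0 ≤ T * (4 * k * deviation n k m T) := by unfold deviation; positivity
  rcases le_total (rsAccuracy n k m T) 1 with hε1 | hε1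
  · have hNr := card_queries_mul_rsPlays_le hk hkn hm hT hε1
    have hmin : ∀ O : Finset (Fin n), O.card = k → _ :=
      fun O hO => avg_min_rsSampleSize_ge hk hkn hε hε1 hO
    have hqpos := rsSampleSize_pos hk hkn hε hε1
    have hsq := two_mul_deviation_sq hk hkn hm hT
    set ε := rsAccuracy n k m T
    set q := rsSampleSize n k ε
    set r := rsPlays n k m T
    set ξ := deviation n k m T
    set N := k * (1 + q) with hN
    have hs0 : 0 < (k : ℝ) * q / n := by positivity
    have hξ0 : 0 ≤ ξ := Real.sqrt_nonneg _
    -- If exploration fills the horizon, the trivial bound `T` is already at most `N r`. Otherwise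
    -- `N ≤ T`, and the union bound `2 N / T²` is at most `2 / T`.
    rcases le_total (T : ℝ) ((N * r : ℕ) : ℝ) with hTN | hTN
    · linarith
    · have hNT : (N : ℝ) ≤ T := by
        refine le_trans ?_ hTN
        exact_mod_cast Nat.le_mul_of_pos_right N hr
      have hout := integral_output_ge (ν := ν) hf h0 hk hkn (rsSampleSize_le n k ε) rfl hs0 hε.le
        hε1 hmin hξ0 hopt hν hm hmm hr
      rw [hsq, ← hN] at hout
      have hexp : Real.exp (-(2 * Real.log T)) = ((T : ℝ) ^ 2)⁻¹ := by
        rw [Real.exp_neg, two_mul, Real.exp_add, Real.exp_log hT0, sq]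
      rw [hexp] at hout
      have hS := mem_Icc_of_isRewardLaw hν hopt.1
      have hbad : (N : ℝ) * (2 * ((T : ℝ) ^ 2)⁻¹) ≤ 2 * (T : ℝ)⁻¹ := by
        calc (N : ℝ) * (2 * ((T : ℝ) ^ 2)⁻¹) ≤ T * (2 * ((T : ℝ) ^ 2)⁻¹) := by gcongr
          _ = 2 * (T : ℝ)⁻¹ := by field_simp
      have hεf : ε * ((Real.exp 1)⁻¹ * f Sopt) ≤ ε := by
        have : (Real.exp 1)⁻¹ * f Sopt ≤ 1 := by nlinarith [hS.1, hS.2]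
        nlinarith
      have hreg := integral_rsRegret_le (q := q) (m := m) (m' := m') hν h0 hα0 hα1
        (rsSampleSize_le n k ε) ((k : ℝ) * q / n) hr T i hopt.1
        (D := ε + 4 * k * ξ + 2 * (T : ℝ)⁻¹) (by positivity) (by nlinarith)
      refine hreg.trans ?_
      have e3 : T * (ε + 4 * k * ξ + 2 * (T : ℝ)⁻¹) = T * ε + T * (4 * k * ξ) + 2 := by
        field_simp
      rw [e3, ← hN]
      linarith
  -- For accuracy at least `1` the trivial bound `T` is at most `T ε`.
  · have h1 : (T : ℝ) ≤ T * rsAccuracy n k m T := le_mul_of_one_le_right hT0.le hε1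
    have h2 : T * rsAccuracy n k m T ≤ (5 + 16 * Real.log T) * (T * rsAccuracy n k m T) :=
      le_mul_of_one_le_left (hT0.le.trans h1) (by linarith)
    linarith

theorem rsSubroutine_eq :
    rsSubroutine n k m T = randomSampling n k (rsAccuracy n k m T) := by
  unfold rsSubroutine
  rw [accuracy_eq]

theorem ae_commRounds_eq (ν : Measure (Finset (Fin n) → ℝ)) :
    ∀ᵐ ω ∂(outcomeLaw m' m (rsSubroutine n k m T) ν),
      commRounds m (rsPlays n k m T) ω =
        k * (1 + rsSampleSize n k (rsAccuracy n k m T)) := by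
  rw [rsSubroutine_eq]
  -- `outcomeLaw` and `exploration` for RandomSampling unfold to `jointLaw` and `rsRun`.
  exact ae_length_rsRun (k := k) (m := m) (m' := m') (ν := ν)
    (rsSampleSize_le n k (rsAccuracy n k m T))
    ((k : ℝ) * rsSampleSize n k (rsAccuracy n k m T) / n) (rsPlays n k m T)

end Bound

end

end CMAMAB

theorem mainTheorem7 :
    (∃ C a : ℝ, 0 < C ∧ 0 ≤ a ∧
      ∀ (n k m m' T : ℕ), 1 ≤ k → k ≤ n → 1 ≤ m → m ≤ m' → 2 ≤ T →
      ∀ (ν : MeasureTheory.Measure (Finset (Fin n) → ℝ)) [MeasureTheory.IsProbabilityMeasure ν],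
        ∀ᵐ ω ∂(CMAMAB.outcomeLaw m' m (CMAMAB.rsSubroutine n k m T) ν),
          (CMAMAB.commRounds m (CMAMAB.rsPlays n k m T) ω : ℝ) ≤
            C * Real.log T ^ a * (n * (T : ℝ) ^ (2 / 3 : ℝ))) ∧
    (∃ C a : ℝ, 0 < C ∧ 0 ≤ a ∧
      ∀ (n k m m' T : ℕ), 1 ≤ k → k ≤ n → 1 ≤ m → m ≤ m' → 2 ≤ T →
      (n : ℝ) * (m : ℝ) ^ (3 / 2 : ℝ) / (4 * k) ^ 3 ≤ T →
      ∀ (f : Finset (Fin n) → ℝ) (ν : MeasureTheory.Measure (Finset (Fin n) → ℝ))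
        [MeasureTheory.IsProbabilityMeasure ν],
        (∀ A, 0 ≤ f A) → CMAMAB.IsSubmodular f → CMAMAB.IsRewardLaw k f ν →
      ∀ Sopt : Finset (Fin n), CMAMAB.IsOptimal f k Sopt → ∀ i : Fin m',
        MeasureTheory.Integrable
          (CMAMAB.regret (alg := CMAMAB.rsSubroutine n k m T) (Real.exp 1)⁻¹ m
            (CMAMAB.rsPlays n k m T) T Sopt i)
          (CMAMAB.outcomeLaw m' m (CMAMAB.rsSubroutine n k m T) ν) ∧
        ∫ ω, CMAMAB.regret (Real.exp 1)⁻¹ m (CMAMAB.rsPlays n k m T) T Sopt i ω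
            ∂(CMAMAB.outcomeLaw m' m (CMAMAB.rsSubroutine n k m T) ν) ≤
          C * Real.log T ^ a *
            ((m : ℝ) ^ (-(1 / 5) : ℝ) * (k : ℝ) ^ (2 / 5 : ℝ) * (n : ℝ) ^ (1 / 5 : ℝ) *
              (T : ℝ) ^ (4 / 5 : ℝ))) := by
  refine ⟨⟨20, 1, by norm_num, zero_le_one, ?_⟩, ⟨400, 2, by norm_num, zero_le_two, ?_⟩⟩
  · intro n k m m' T hk hkn hm hmm hT ν _
    filter_upwards [CMAMAB.ae_commRounds_eq ν] with ω hω
    rw [hω]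
    exact CMAMAB.card_queries_le_horizon hk hkn hm hT
  · intro n k m m' T hk hkn hm hmm hT hTn f ν _ h0 hf hν Sopt hopt i
    rw [CMAMAB.rsSubroutine_eq]
    exact ⟨CMAMAB.integrable_rsRegret
      (q := CMAMAB.rsSampleSize n k (CMAMAB.rsAccuracy n k m T)) (m := m) hν (Real.exp 1)⁻¹
      ((k : ℝ) * CMAMAB.rsSampleSize n k (CMAMAB.rsAccuracy n k m T) / n)
      (CMAMAB.rsPlays n k m T) T i hopt.1,
      CMAMAB.integral_rsRegret_rate_le hk hkn hm hmm hT hTn h0 hf hν hopt i⟩
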